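/- Let $d\ge 3$ and $k\ge 0$ be integers. A lattice $d$-simplex is the convex hull $T\subset\mathbb R^d$ of $d+1$ affinely independent points of $\mathbb Z^d$; it is called clean if the only lattice points on its boundary are its vertices, i.e. $\partial T\cap\mathbb Z^d=V(T)$. Let $\mathcal S_k^d$ denote the set of clean lattice $d$-simplices with exactly $k$ lattice points in the interior. Two subsets $P,Q$ of $\mathbb R^d$ are unimodularly equivalent, $P\simeq Q$, if $P=f(Q)$ for some map $f(x)=x\cdot M+u$ (points being row vectors) with $u\in\mathbb Z^d$, $M$ an integer $d\times d$ matrix and $\det M=\pm1$. Put $S_d(k)=\operatorname{conv}\left(e_1,\dots,e_d,-k\sum_{i=1}^d e_i\right)$, where $e_1,\dots,e_d$ are the standard unit vectors, and let $\operatorname{Vol}$ be Lebesgue measure on $\mathbb R^d$. Then: 1. for every $T\in\mathcal S_k^d$, $\operatorname{Vol}(T)=\frac{dk+1}{d!}$ if and only if $T\simeq S_d(k)$; 2. $S_d(k)\in\mathcal S_k^d$; 3. $\operatorname{Vol}(T)\ge\frac{dk+1}{d!}$ for every $T\in\mathcal S_k^d$. In particular, the simplices of least volume in $\mathcal S_k^d$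 form exactly one class under unimodular equivalence. -/

import Mathlib

open MeasureTheory
open scoped Nat Matrix

/-- The inclusion of `ℤ^d` into `ℝ^d`. -/
def latticePoint {d : ℕ} (z : Fin d → ℤ) : Fin d → ℝ := fun i => (z i : ℝ)

/-- The integer lattice `ℤ^d` as a subset of `ℝ^d`. -/
def integerLattice (d : ℕ) : Set (Fin d → ℝ) := Set.range (latticePoint (d := d))

/-- `T` is a (nondegenerate) lattice `d`-simplex in `ℝ^d`: the convex hull of `d + 1` affinely
independent lattice points. -/
def IsLatticeSimplex {d : ℕ} (T : Set (Fin d → ℝ)) : Prop :=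
  ∃ v : Fin (d + 1) → Fin d → ℤ,
    AffineIndependent ℝ (fun j => latticePoint (v j)) ∧
      T = convexHull ℝ (Set.range fun j => latticePoint (v j))

/-- `P` is clean: the lattice points on its boundary are exactly its vertices (extreme points). -/
def IsClean {d : ℕ} (P : Set (Fin d → ℝ)) : Prop :=
  frontier P ∩ integerLattice d = P.extremePoints ℝ

/-- The collection of clean lattice `d`-simplices with exactly `k` interior lattice points. -/
def cleanSimplices (d k : ℕ) : Set (Set (Fin d → ℝ)) :=
  {T | IsLatticeSimplex T ∧ IsClean T ∧ (interior T ∩ integerLattice d).encard = k}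

/-- The affine map `x ↦ x · M + u` of `ℝ^d` (points are row vectors) given by integral data. -/
def integralAffineMap {d : ℕ} (M : Matrix (Fin d) (Fin d) ℤ) (u : Fin d → ℤ)
    (x : Fin d → ℝ) : Fin d → ℝ :=
  x ᵥ* M.map (fun n : ℤ => (n : ℝ)) + latticePoint u

/-- Unimodular equivalence: `P` is the image of `Q` under a unimodular transformation. -/
def UnimodularEquiv {d : ℕ} (P Q : Set (Fin d → ℝ)) : Prop :=
  ∃ (M : Matrix (Fin d) (Fin d) ℤ) (u : Fin d → ℤ),
    (M.det = 1 ∨ M.det = -1) ∧ P = integralAffineMap M u '' Q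

theorem integralAffineMap_comp {d : ℕ} (M N : Matrix (Fin d) (Fin d) ℤ) (u w : Fin d → ℤ)
    (x : Fin d → ℝ) :
    integralAffineMap N w (integralAffineMap M u x) =
      integralAffineMap (M * N) (u ᵥ* N + w) x := by
  have hmul : (M * N).map (fun n : ℤ => (n : ℝ)) =
      M.map (fun n : ℤ => (n : ℝ)) * N.map (fun n : ℤ => (n : ℝ)) := by
    ext i j
    simp [Matrix.mul_apply]
  have hvec : latticePoint (u ᵥ* N + w) =
      latticePoint u ᵥ* N.map (fun n : ℤ => (n : ℝ)) + latticePoint w := by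
    ext i
    simp [latticePoint, Matrix.vecMul, dotProduct]
  simp only [integralAffineMap, hmul, hvec, Matrix.add_vecMul, Matrix.vecMul_vecMul, add_assoc]

theorem integralAffineMap_one {d : ℕ} (x : Fin d → ℝ) :
    integralAffineMap (1 : Matrix (Fin d) (Fin d) ℤ) 0 x = x := by
  have h : (1 : Matrix (Fin d) (Fin d) ℤ).map (fun n : ℤ => (n : ℝ)) = 1 := by
    ext i j
    by_cases hij : i = j <;> simp [Matrix.one_apply, hij]
  have h0 : latticePoint (0 : Fin d → ℤ) = 0 := by
    ext i
    simp [latticePoint]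
  simp [integralAffineMap, h, h0]

/-- Unimodular equivalence as an equivalence relation on the subsets of `ℝ^d`. -/
def unimodularSetoid (d : ℕ) : Setoid (Set (Fin d → ℝ)) where
  r := UnimodularEquiv
  iseqv :=
    { refl := fun P => ⟨1, 0, Or.inl Matrix.det_one, by
        simp only [integralAffineMap_one, Set.image_id']⟩
      symm := by
        rintro P Q ⟨M, u, hM, rfl⟩
        have hu : IsUnit M.det := Int.isUnit_iff.mpr hM
        refine ⟨M⁻¹, -(u ᵥ* M⁻¹), ?_, ?_⟩
        · exact Int.isUnit_iff.mp (Matrix.isUnit_nonsing_inv_det M hu)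
        · simp only [Set.image_image, integralAffineMap_comp, Matrix.mul_nonsing_inv M hu,
            add_neg_cancel, integralAffineMap_one, Set.image_id']
      trans := by
        rintro P Q R ⟨M, u, hM, rfl⟩ ⟨N, w, hN, rfl⟩
        refine ⟨N * M, w ᵥ* M + u, ?_, ?_⟩
        · rw [← Int.isUnit_iff] at hM hN ⊢
          rw [Matrix.det_mul]
          exact hN.mul hM
        · simp only [Set.image_image, integralAffineMap_comp] }

/-- The simplex `S_d(k) = conv(e_1, …, e_d, -k (e_1 + ⋯ + e_d))`. -/
def standardSimplex (d k : ℕ) : Set (Fin d → ℝ) :=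
  convexHull ℝ
    (insert (-(k : ℝ) • ∑ i : Fin d, (Pi.single i 1 : Fin d → ℝ))
      (Set.range fun i : Fin d => (Pi.single i 1 : Fin d → ℝ)))

/-- The members of `cleanSimplices d k` whose volume is least among all members. -/
def minimalVolumeSimplices (d k : ℕ) : Set (Set (Fin d → ℝ)) :=
  {T | T ∈ cleanSimplices d k ∧ ∀ T' ∈ cleanSimplices d k, volume.real T ≤ volume.real T'}

/-! Let T have vertices v_i and put N = d!·Vol(T). Barycentric coordinates of lattice points,
multiplied by N and reduced mod N, live in a finite group G inside (ℤ/N)^{d+1}, the kernel mod N of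
the matrix of homogeneous vertices; |G| ≤ N by `card_modularKernel_le`. The sum of the least
residues of an element is N times an integer between 0 and d, its height, and height is subadditive.
Cleanness says that an element of height one has no zero coordinate. Hence these elements correspond
to the k interior lattice points, and their negatives have height d.

Lower bound. Let L_j be the set of elements of height at most j. Then L_j + L_1 ⊆ L_{j+1}, and for j
< d zero has only the trivial representation in L_j + L_1. Scherk's theorem gives |L_{j+1}| ≥ |L_j|
+ k, so N ≥ |G| = |L_d| ≥ dk + 1.

Equality, k ≥ 1. Every inequality is tight, so B = L_1 satisfies |B + B| = 2|B| - 1 when k ≥ 2.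
Tightness also makes each coordinate injective on G (`coord_ne_zero`), and summing coordinates then
shows that B fills at most about half of any coset. This excludes the subgroup obstructions in a
Vosper-type theorem, proved by the method of atoms (`exists_atom`, `exists_card_union_vadd_le`), and
B = {0, h, …, kh}. The heights of enough multiples of g = kh are now known to force its coordinates
to be k, …, k, 1 up to order (`exists_coord_eq`). So a lattice point z satisfies v_{i₀} + k ∑_{i ≠
i₀} v_i = (dk + 1) z, and the affine map sending 0 to z and the e_i to the v_i with i ≠ i₀ carries
S_d(k) onto T. Its determinant is ±1 by comparison of volumes. -/

/-! ### Scherk's theorem and atoms in finite abelian groups -/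

section SumsetBounds

open Finset
open scoped Pointwise

variable {G : Type*} [AddCommGroup G] [DecidableEq G]

/-- **Scherk's theorem.** If `0 ∈ A ∩ B` and `0` has only the trivial representation in `A + B`,
then `|A + B| ≥ |A| + |B| - 1`. -/
theorem card_add_card_le_card_add_of_unique_zero [Finite G] (A B : Finset G) (hA : 0 ∈ A)
    (hB : 0 ∈ B) (h : ∀ a ∈ A, ∀ b ∈ B, a + b = 0 → b = 0) : #A + #B ≤ #(A + B) + 1 := by
  induction hn : #B using Nat.strong_induction_on generalizing A B with
  | _ n ih =>
  subst hn
  by_cases hstab : ∀ a ∈ A, ∀ b ∈ B, a + b ∈ A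
  · have hB1 : B = {0} := by
      refine eq_singleton_iff_unique_mem.mpr ⟨hB, fun b hb => ?_⟩
      have hmul : ∀ m : ℕ, m • b ∈ A := by
        intro m
        induction m with
        | zero => simpa using hA
        | succ m ihm => rw [succ_nsmul]; exact hstab _ ihm _ hb
      refine h ((addOrderOf b - 1) • b) (hmul _) b hb ?_
      rw [← succ_nsmul, Nat.sub_add_cancel (addOrderOf_pos b),
        addOrderOf_nsmul_eq_zero]
    subst hB1
    simp
  · push Not at hstab
    obtain ⟨a, ha, b, hb, hab⟩ := hstab
    -- The Dyson transform preserves the sum of the two cardinalities and does not enlarge the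
    -- sumset; since a + b ∉ A, it strictly shrinks B.
    have hcard := addDysonETransform.card a (A, B)
    have hsub := addDysonETransform.subset a (A, B)
    simp only [addDysonETransform_fst, addDysonETransform_snd] at hcard hsub
    have hlt : #(B ∩ (-a +ᵥ A)) < #B := by
      refine card_lt_card ⟨inter_subset_left, fun hsubset => hab ?_⟩
      have := (mem_inter.mp (hsubset hb)).2
      rw [mem_vadd_finset] at this
      obtain ⟨c, hc, hcb⟩ := this
      simp only [vadd_eq_add] at hcb
      rw [← hcb]
      simpa using hc
    have key := ih _ hlt (A ∪ (a +ᵥ B)) (B ∩ (-a +ᵥ A)) (mem_union_left _ hA)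
      (mem_inter.mpr ⟨hB, mem_vadd_finset.mpr ⟨a, ha, by simp⟩⟩) ?_ rfl
    · have := card_le_card hsub
      omega
    · intro x hx y hy hxy
      obtain ⟨hyB, hyA⟩ := mem_inter.mp hy
      rcases mem_union.mp hx with hx | hx
      · exact h x hx y hyB hxy
      · obtain ⟨c, hc, rfl⟩ := mem_vadd_finset.mp hx
        obtain ⟨e, he, rfl⟩ := mem_vadd_finset.mp hyA
        simp only [vadd_eq_add] at *
        -- The mixed case: (a + c) + (-a + e) = 0 is again a zero sum e + c with e ∈ A and c ∈ B.
        -- Both vanish, which leaves -a ∈ B to be paired with a ∈ A.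
        have hec : e + c = 0 := by rw [← hxy]; abel
        have hc0 := h e he c hc hec
        have he0 : e = 0 := by simpa [hc0] using hec
        subst he0
        have := h a ha (-a + 0) hyB (by simp)
        simpa using this

/-- A `2`-atom of `B` relative to a subgroup `K` containing `B`: a critical set all of whose
distinct translates meet it in at most one point. -/
theorem exists_atom [Fintype G] (K : AddSubgroup G) (B X : Finset G) (hBK : ∀ b ∈ B, b ∈ K)
    (hB : B.Nonempty) (hXK : ∀ x ∈ X, x ∈ K) (hX2 : 2 ≤ #X) (hXB2 : #(X + B) + 2 ≤ Nat.card K)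
    (hXB : #(X + B) < #X + #B) :
    ∃ M : Finset G, 0 ∈ M ∧ (∀ x ∈ M, x ∈ K) ∧ 2 ≤ #M ∧ #(M + B) + 2 ≤ Nat.card K ∧
      #(M + B) < #M + #B ∧ ∀ g : G, 2 ≤ #(M ∩ (g +ᵥ M)) → g +ᵥ M = M := by
  classical
  let Kf : Finset G := univ.filter (· ∈ K)
  have hKf : #Kf = Nat.card K := by
    rw [Nat.card_eq_fintype_card, Fintype.card_subtype]
  let P : Finset G → Prop := fun Y => (∀ x ∈ Y, x ∈ K) ∧ 2 ≤ #Y ∧ #(Y + B) + 2 ≤ Nat.card K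
  let f : Finset G → ℕ := fun Y => #(Y + B) - #Y
  have hle : ∀ Y : Finset G, #Y ≤ #(Y + B) := fun Y => card_le_card_add_right hB
  -- Minimize the excess |Y + B| - |Y| first, then the cardinality among the minimizers; a final
  -- translation puts 0 into the set.
  obtain ⟨M₁, hM₁, hmin₁⟩ := exists_min_image (univ.filter P) f
    ⟨X, mem_filter.mpr ⟨mem_univ _, hXK, hX2, hXB2⟩⟩
  obtain ⟨M₂, hM₂, hmin₂⟩ := exists_min_image ((univ.filter P).filter (fun Y => f Y = f M₁)) card
    ⟨M₁, mem_filter.mpr ⟨hM₁, rfl⟩⟩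
  obtain ⟨hM₂P, hM₂f⟩ := mem_filter.mp hM₂
  have hM₂P : P M₂ := (mem_filter.mp hM₂P).2
  have hminf : ∀ Y, P Y → f M₂ ≤ f Y := fun Y hY => by
    rw [hM₂f]; exact hmin₁ Y (mem_filter.mpr ⟨mem_univ _, hY⟩)
  have hminc : ∀ Y, P Y → f Y ≤ f M₂ → #M₂ ≤ #Y := fun Y hY hfY =>
    hmin₂ Y (mem_filter.mpr ⟨mem_filter.mpr ⟨mem_univ _, hY⟩,
      (le_antisymm hfY (hminf Y hY)).trans hM₂f⟩)
  have hne : M₂.Nonempty := card_pos.mp (by have := hM₂P.2.1; omega)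
  obtain ⟨m, hm⟩ := hne
  have hadd : ∀ (g : G) (Y : Finset G), #((g +ᵥ Y) + B) = #(Y + B) := fun g Y => by
    rw [vadd_add_assoc, card_vadd_finset]
  obtain ⟨M, hMdef⟩ : ∃ M, M = -m +ᵥ M₂ := ⟨_, rfl⟩
  have hcM : #M = #M₂ := by rw [hMdef, card_vadd_finset]
  have hcMB : #(M + B) = #(M₂ + B) := by rw [hMdef, hadd]
  have hfM : f M = f M₂ := by simp only [f, hcM, hcMB]
  have hMK : ∀ x ∈ M, x ∈ K := by
    intro x hx
    rw [hMdef] at hx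
    obtain ⟨y, hy, rfl⟩ := mem_vadd_finset.mp hx
    exact K.add_mem (K.neg_mem (hM₂P.1 m hm)) (hM₂P.1 y hy)
  have h2M : 2 ≤ #M := hcM ▸ hM₂P.2.1
  have hMB2 : #(M + B) + 2 ≤ Nat.card K := hcMB ▸ hM₂P.2.2
  rw [← hfM] at hminf hminc
  rw [← hcM] at hminc
  have hXf := hminf X ⟨hXK, hX2, hXB2⟩
  have hfval : ∀ Y, #(Y + B) = #Y + f Y := fun Y => by
    have := hle Y
    simp only [f]; omega
  refine ⟨M, ?_, hMK, h2M, hMB2, ?_, ?_⟩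
  · rw [hMdef]; exact mem_vadd_finset.mpr ⟨m, hm, by simp⟩
  · have h1 := hfval M
    have h2 := hfval X
    omega
  intro g hg
  by_contra hne
  have hgcard : #(g +ᵥ M) = #M := card_vadd_finset _ _
  have hgK : ∀ x ∈ g +ᵥ M, x ∈ K := by
    obtain ⟨y, hy⟩ : (M ∩ (g +ᵥ M)).Nonempty := card_pos.mp (by omega)
    obtain ⟨hyM, hyg⟩ := mem_inter.mp hy
    obtain ⟨z, hz, hzy⟩ := mem_vadd_finset.mp hyg
    have hgK : g ∈ K := by
      have : g = y - z := by rw [← hzy, vadd_eq_add]; abel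
      rw [this]; exact K.sub_mem (hMK _ hyM) (hMK _ hz)
    intro x hx
    obtain ⟨w, hw, rfl⟩ := mem_vadd_finset.mp hx
    exact K.add_mem hgK (hMK _ hw)
  have hIlt : #(M ∩ (g +ᵥ M)) < #M := by
    refine lt_of_le_of_ne (card_le_card inter_subset_left) fun heq => hne ?_
    have h1 := eq_of_subset_of_card_le (inter_subset_left (s₁ := M) (s₂ := g +ᵥ M)) heq.ge
    exact (eq_of_subset_of_card_le (inter_eq_left.mp h1) hgcard.le).symm
  have hPI : P (M ∩ (g +ᵥ M)) :=
    ⟨fun x hx => hMK x (mem_inter.mp hx).1, hg,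
      le_trans (by gcongr; exact inter_subset_left) hMB2⟩
  have hfI : f M < f (M ∩ (g +ᵥ M)) := by
    by_contra hcon
    have := hminc _ hPI (not_lt.mp hcon)
    omega
  -- the dual set
  have hdual1 : #((Kf \ (M + B)).image (fun x => -x)) + #(M + B) = Nat.card K := by
    rw [card_image_of_injective _ neg_injective, card_sdiff_add_card_eq_card, hKf]
    intro x hx
    obtain ⟨y, hy, z, hz, rfl⟩ := mem_add.mp hx
    exact mem_filter.mpr ⟨mem_univ _, K.add_mem (hMK _ hy) (hBK _ hz)⟩
  have hdual2 : #((Kf \ (M + B)).image (fun x => -x) + B) + #M ≤ Nat.card K := by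
    have hMKf : M ⊆ Kf := fun x hx => mem_filter.mpr ⟨mem_univ _, hMK x hx⟩
    have hsub : (Kf \ (M + B)).image (fun x => -x) + B ⊆ (Kf \ M).image (fun x => -x) := by
      intro x hx
      obtain ⟨y, hy, z, hz, rfl⟩ := mem_add.mp hx
      obtain ⟨w, hw, rfl⟩ := mem_image.mp hy
      obtain ⟨hwK, hwM⟩ := mem_sdiff.mp hw
      refine mem_image.mpr ⟨w - z, mem_sdiff.mpr ⟨mem_filter.mpr ⟨mem_univ _, ?_⟩, fun hwz => ?_⟩,
        by abel⟩
      · exact K.sub_mem (mem_filter.mp hwK).2 (hBK _ hz)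
      · exact hwM (mem_add.mpr ⟨_, hwz, z, hz, by abel⟩)
    have := card_le_card hsub
    rw [card_image_of_injective _ neg_injective] at this
    have h3 := card_sdiff_add_card_eq_card hMKf
    omega
  have hPdual : P ((Kf \ (M + B)).image (fun x => -x)) := by
    refine ⟨fun x hx => ?_, by omega, by omega⟩
    obtain ⟨w, hw, rfl⟩ := mem_image.mp hx
    exact K.neg_mem (mem_filter.mp (mem_sdiff.mp hw).1).2
  have hfM' := hfval M
  -- The dual set has excess at most that of M, so it is at least as large as M. This yields 2|M| +
  -- f(M) ≤ |K|, the room needed to make the union below admissible.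
  have hdual3 : #M ≤ #((Kf \ (M + B)).image (fun x => -x)) := by
    refine hminc _ hPdual ?_
    have := hfval ((Kf \ (M + B)).image (fun x => -x))
    omega
  -- Submodularity of the excess: the intersection is smaller than M, so its excess exceeds the
  -- minimum, and the union would fall below the minimum.
  have hU1 := card_union_add_card_inter M (g +ᵥ M)
  have hU2 := card_union_add_card_inter (M + B) ((g +ᵥ M) + B)
  rw [← union_add, hadd] at hU2
  have hU3 : #((M ∩ (g +ᵥ M)) + B) ≤ #((M + B) ∩ ((g +ᵥ M) + B)) :=
    card_le_card inter_add_subset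
  have hfI' := hfval (M ∩ (g +ᵥ M))
  have hPU : P (M ∪ (g +ᵥ M)) := by
    refine ⟨fun x hx => ?_, by omega, by omega⟩
    rcases mem_union.mp hx with hx | hx
    · exact hMK x hx
    · exact hgK x hx
  have := hminf _ hPU
  have := hfval (M ∪ (g +ᵥ M))
  omega

/-- A set meeting its distinct translates in at most one point is a subgroup or has no period. -/
theorem coe_addSubgroup_or_card_inter_vadd_le_one [Finite G] (M : Finset G) (h0 : 0 ∈ M)
    (hM : ∀ g : G, 2 ≤ #(M ∩ (g +ᵥ M)) → g +ᵥ M = M) :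
    (∃ H : AddSubgroup G, (H : Set G) = M) ∨ ∀ g : G, g ≠ 0 → #(M ∩ (g +ᵥ M)) ≤ 1 := by
  by_cases hper : ∃ g : G, g ≠ 0 ∧ g +ᵥ M = M
  · left
    obtain ⟨g, hg0, hg⟩ := hper
    have hadd : ∀ x ∈ M, ∀ y ∈ M, x + y ∈ M := by
      intro x hx y hy
      have hxM : x +ᵥ M = M := by
        -- Because g is a period, M and x + M share the two points x and x + g.
        refine hM x (one_lt_card.mpr ⟨x, ?_, x + g, ?_, by simpa using hg0⟩)
        · exact mem_inter.mpr ⟨hx, mem_vadd_finset.mpr ⟨0, h0, by simp⟩⟩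
        · refine mem_inter.mpr ⟨?_, mem_vadd_finset.mpr ⟨g, ?_, by simp⟩⟩
          · rw [← hg]; exact mem_vadd_finset.mpr ⟨x, hx, by simp [add_comm]⟩
          · rw [← hg]; exact mem_vadd_finset.mpr ⟨0, h0, by simp⟩
      rw [← hxM]
      exact mem_vadd_finset.mpr ⟨y, hy, by simp⟩
    have hmul : ∀ x ∈ M, ∀ m : ℕ, m • x ∈ M := by
      intro x hx m
      induction m with
      | zero => simpa using h0
      | succ m ihm => rw [succ_nsmul]; exact hadd _ ihm _ hx
    refine ⟨{ carrier := M, zero_mem' := h0, add_mem' := fun {x y} hx hy => hadd x hx y hy,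
              neg_mem' := fun {x} hx => ?_ }, rfl⟩
    have : -x = (addOrderOf x - 1) • x := by
      rw [neg_eq_iff_add_eq_zero, ← succ_nsmul',
        Nat.sub_add_cancel (addOrderOf_pos x), addOrderOf_nsmul_eq_zero]
    rw [this]
    exact hmul x hx _
  · right
    intro g hg
    by_contra hcon
    exact hper ⟨g, hg, hM g (by omega)⟩

end SumsetBounds

/-! ### A Vosper-type theorem -/

section CriticalPairs

open Finset
open scoped Pointwise

variable {G : Type*} [AddCommGroup G] [DecidableEq G]

theorem card_vadd_inter_vadd_le_one {M : Finset G}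
    (hM : ∀ g : G, g ≠ 0 → #(M ∩ (g +ᵥ M)) ≤ 1) {x y : G} (hxy : x ≠ y) :
    #((x +ᵥ M) ∩ (y +ᵥ M)) ≤ 1 := by
  have h := hM (y - x) (sub_ne_zero.mpr hxy.symm)
  have : (x +ᵥ M) ∩ (y +ᵥ M) = x +ᵥ (M ∩ ((y - x) +ᵥ M)) := by
    rw [vadd_finset_inter, vadd_vadd, add_sub_cancel]
  rwa [this, card_vadd_finset]

theorem two_mul_card_le_card_add {M L : Finset G}
    (hM : ∀ g : G, g ≠ 0 → #(M ∩ (g +ᵥ M)) ≤ 1) (hL : 2 ≤ #L) : 2 * #M ≤ #(L + M) + 1 := by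
  obtain ⟨x, hx, y, hy, hxy⟩ := one_lt_card.mp hL
  have h1 := card_vadd_inter_vadd_le_one hM hxy
  have h2 := card_union_add_card_inter (x +ᵥ M) (y +ᵥ M)
  have h3 : #((x +ᵥ M) ∪ (y +ᵥ M)) ≤ #(L + M) :=
    card_le_card (union_subset (vadd_finset_subset_add hx) (vadd_finset_subset_add hy))
  simp only [card_vadd_finset] at h2
  omega

/-- Three translates of M lie in L + M, and their three pairwise overlaps cost at most one point
each. -/
theorem three_mul_card_le_card_add {M L : Finset G}
    (hM : ∀ g : G, g ≠ 0 → #(M ∩ (g +ᵥ M)) ≤ 1) (hL : 3 ≤ #L) : 3 * #M ≤ #(L + M) + 3 := by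
  obtain ⟨x, hx, y, hy, z, hz, hxy, hxz, hyz⟩ := two_lt_card.mp hL
  have h1 := card_vadd_inter_vadd_le_one hM hxy
  have h1' := card_vadd_inter_vadd_le_one hM hxz
  have h1'' := card_vadd_inter_vadd_le_one hM hyz
  have h2 := card_union_add_card_inter (x +ᵥ M) (y +ᵥ M)
  have h2' := card_union_add_card_inter ((x +ᵥ M) ∪ (y +ᵥ M)) (z +ᵥ M)
  rw [union_inter_distrib_right] at h2'
  have h2'' := card_union_le ((x +ᵥ M) ∩ (z +ᵥ M)) ((y +ᵥ M) ∩ (z +ᵥ M))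
  have h3 : #((x +ᵥ M) ∪ (y +ᵥ M) ∪ (z +ᵥ M)) ≤ #(L + M) :=
    card_le_card (union_subset (union_subset (vadd_finset_subset_add hx)
      (vadd_finset_subset_add hy)) (vadd_finset_subset_add hz))
  simp only [card_vadd_finset] at h2 h2'
  omega

open scoped Classical in
theorem card_filter_sub_mem {A : Type*} [AddCommGroup A] [Fintype A] (K : AddSubgroup A) (x : A) :
    #(univ.filter fun g => g - x ∈ K) = Nat.card K := by
  rw [Nat.card_eq_fintype_card, Fintype.card_subtype]
  refine card_bij (fun g _ => g - x) (fun g hg => by simpa using hg) (fun a _ b _ h => ?_)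
    fun b hb => ⟨b + x, by simpa using hb, by simp⟩
  simpa using h

open scoped Classical in
/-- If each coset of `H` is at most about half filled by `B`, and `B ⊄ H`, then
`|H + B| ≥ |H| + |B|`. -/
theorem card_add_card_le_card_subgroup_add [Fintype G] (B Hf : Finset G) (H : AddSubgroup G)
    (hHf : (H : Set G) = Hf) (h0 : 0 ∈ B)
    (hcoset : ∀ x, 2 * #(B.filter fun b => b - x ∈ H) ≤ Nat.card H + 1)
    (hsub : 2 * #(B.filter fun b => b ∈ H) ≤ Nat.card H)
    (hBH : ∃ b ∈ B, b ∉ H) : #Hf + #B ≤ #(Hf + B) := by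
  obtain ⟨b, hb, hbH⟩ := hBH
  have hmem : ∀ g, g ∈ Hf ↔ g ∈ H := fun g => by
    simpa using (Set.ext_iff.mp hHf g).symm
  have hcard : #Hf = Nat.card H := by
    rw [← SetLike.coe_sort_coe, hHf]; simp
  have hC : ∀ x, #((univ.filter fun g => g - x ∈ H) \ B) +
      #(B.filter fun c => c - x ∈ H) = Nat.card H := by
    intro x
    rw [← card_filter_sub_mem H x, ← card_sdiff_add_card_inter (univ.filter fun g => g - x ∈ H) B]
    congr 2
    ext c
    simp [and_comm]
  have hdisj : Disjoint ((univ.filter fun g => g - 0 ∈ H) \ B)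
      ((univ.filter fun g => g - b ∈ H) \ B) := by
    rw [disjoint_left]
    intro g hg hg'
    simp only [mem_sdiff, mem_filter, mem_univ, true_and, sub_zero] at hg hg'
    refine hbH ?_
    have := H.sub_mem hg.1 hg'.1
    simpa using this
  have hsubset : ∀ x ∈ B, (univ.filter fun g => g - x ∈ H) \ B ⊆ (Hf + B) \ B := by
    intro x hx g hg
    simp only [mem_sdiff, mem_filter, mem_univ, true_and] at hg
    exact mem_sdiff.mpr ⟨mem_add.mpr ⟨g - x, (hmem _).mpr hg.1, x, hx, by simp⟩, hg.2⟩
  -- Adding H fills the holes of B in the two cosets H and b + H. Each is about half empty, so at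
  -- least |H| new points appear; parity absorbs the +1 in `hcoset`.
  have h1 := card_le_card (union_subset (hsubset 0 h0) (hsubset b hb))
  rw [card_union_of_disjoint hdisj] at h1
  have hBsub : B ⊆ Hf + B := fun x hx =>
    mem_add.mpr ⟨0, (hmem 0).mpr H.zero_mem, x, hx, by simp⟩
  have h2 := card_sdiff_add_card_eq_card hBsub
  have h3 := hC 0
  have h4 := hC b
  have h5 := hcoset b
  simp only [sub_zero] at h3
  simp only [sub_zero] at h1
  omega

open scoped Classical in
/-- The part of a critical pair `(M, B)` lying in the subgroup generated by `M`. -/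
theorem exists_critical_in_closure [Fintype G] (B M : Finset G) (h0 : 0 ∈ B) (hM0 : 0 ∈ M)
    (hB2 : 2 ≤ #B)
    (hgen : ∀ K : AddSubgroup G, (∀ b ∈ B, b ∈ K) → K = ⊤)
    (hcoset : ∀ (H : AddSubgroup G) x, 2 * #(B.filter fun b => b - x ∈ H) ≤ Nat.card H + 1)
    (hsub : ∀ H : AddSubgroup G, 2 ≤ Nat.card H →
      2 * #(B.filter fun b => b ∈ H) ≤ Nat.card H)
    (hM3 : 3 ≤ #M) (hMB2 : #(M + B) + 2 ≤ Nat.card G) (hMB : #(M + B) < #M + #B)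
    (hM : ∀ g : G, g ≠ 0 → #(M ∩ (g +ᵥ M)) ≤ 1) :
    ∃ X : Finset G, (∀ x ∈ X, x ∈ AddSubgroup.closure (M : Set G)) ∧ 2 ≤ #X ∧
      #(X + M) + 2 ≤ Nat.card (AddSubgroup.closure (M : Set G)) ∧ #(X + M) < #X + #M := by
  obtain ⟨K, hK⟩ : ∃ K, K = AddSubgroup.closure (M : Set G) := ⟨_, rfl⟩
  rw [← hK]
  have hMK : ∀ m ∈ M, m ∈ K := fun m hm => hK ▸ AddSubgroup.subset_closure hm
  by_cases hBK : ∀ b ∈ B, b ∈ K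
  · have hK' := hgen K hBK
    refine ⟨B, hBK, hB2, ?_, ?_⟩
    · rw [add_comm B M, hK', AddSubgroup.card_top]; exact hMB2
    · rw [add_comm B M, add_comm #B]; exact hMB
  push Not at hBK
  obtain ⟨y, hy, hyK⟩ := hBK
  let C : G → Finset G := fun x => B.filter fun b => b - x ∈ K
  have hMleK : #M ≤ Nat.card K := by
    rw [← card_filter_sub_mem K 0]
    exact card_le_card fun m hm => by simpa using hMK m hm
  have hCsub : ∀ x, C x ⊆ M + C x := fun x c hc => mem_add.mpr ⟨0, hM0, c, hc, by simp⟩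
  have hMC : ∀ x, ∀ g ∈ M + C x, g - x ∈ K := by
    intro x g hg
    obtain ⟨m, hm, c, hc, rfl⟩ := mem_add.mp hg
    rw [add_sub_assoc]
    exact K.add_mem (hMK m hm) (mem_filter.mp hc).2
  have hMCB : ∀ x, (M + C x) \ C x ⊆ (M + B) \ B := by
    intro x g hg
    obtain ⟨hg1, hg2⟩ := mem_sdiff.mp hg
    refine mem_sdiff.mpr ⟨add_subset_add_left (filter_subset _ _) hg1, fun hgB => hg2 ?_⟩
    exact mem_filter.mpr ⟨hgB, hMC x g hg1⟩
  have hdisj : Disjoint ((M + C 0) \ C 0) ((M + C y) \ C y) := by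
    rw [disjoint_left]
    intro g hg hg'
    have h1 := hMC 0 g (mem_sdiff.mp hg).1
    have h2 := hMC y g (mem_sdiff.mp hg').1
    refine hyK ?_
    have := K.sub_mem h1 h2
    simpa using this
  have hsum := card_le_card (union_subset (hMCB 0) (hMCB y))
  rw [card_union_of_disjoint hdisj] at hsum
  have hBsub : B ⊆ M + B := fun x hx => mem_add.mpr ⟨0, hM0, x, hx, by simp⟩
  have hB' := card_sdiff_add_card_eq_card hBsub
  have hex : ∀ x, #((M + C x) \ C x) + #(C x) = #(M + C x) := fun x =>
    card_sdiff_add_card_eq_card (hCsub x)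
  have hmemC : ∀ x ∈ B, x ∈ C x := fun x hx => mem_filter.mpr ⟨hx, by simp⟩
  -- A slice without growth is stable under M, hence under the group K it generates, and so fills a
  -- whole coset of K, against the half bound.
  have hpos : ∀ x ∈ B, 1 ≤ #((M + C x) \ C x) := by
    intro x hx
    by_contra hcon
    have hemp : (M + C x) \ C x = ∅ := card_eq_zero.mp (by omega)
    have hstab : ∀ k ∈ K, ∀ c ∈ C x, k + c ∈ C x := by
      intro k hk
      rw [hK] at hk
      induction hk using AddSubgroup.closure_induction with
      | mem m hm =>
        intro c hc
        exact sdiff_eq_empty_iff_subset.mp hemp (mem_add.mpr ⟨m, hm, c, hc, rfl⟩)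
      | zero => intro c hc; simpa using hc
      | add a b _ _ ha hb => intro c hc; rw [add_assoc]; exact ha _ (hb _ hc)
      | neg a _ ha =>
        intro c hc
        have himg : (C x).image (fun c => a + c) = C x :=
          eq_of_subset_of_card_le (image_subset_iff.mpr ha)
            (card_image_of_injective _ (add_right_injective a)).ge
        obtain ⟨c', hc', rfl⟩ := mem_image.mp (himg ▸ hc)
        simpa using hc'
    have hfull : (univ.filter fun g => g - x ∈ K) ⊆ C x := by
      intro g hg
      have := hstab (g - x) (by simpa using hg) x (hmemC x hx)
      simpa using this
    have h1 := card_le_card hfull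
    rw [card_filter_sub_mem] at h1
    have h2 := hcoset K x
    simp only [C] at h1
    omega
  have hC1 : ∀ x, #(C x) = 1 → #(M + C x) = #M := by
    intro x hx
    obtain ⟨c, hc⟩ := card_eq_one.mp hx
    rw [hc, add_singleton]
    exact card_image_of_injective _ (add_left_injective c)
  have hCpos : ∀ x ∈ B, 1 ≤ #(C x) := fun x hx => card_pos.mpr ⟨x, hmemC x hx⟩
  have p0 := hpos 0 h0
  have py := hpos y hy
  have e0 := hex 0
  have ey := hex y
  have c0 := hCpos 0 h0
  have cy := hCpos y hy
  have u0 := hC1 0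
  have uy := hC1 y
  -- A slice of B, translated into K, is the desired set. The growths of the slices at 0 and y add
  -- up to less than |M| and both are positive, so neither slice is a singleton, whose growth would
  -- be |M| - 1.
  have main : ∀ x, 2 ≤ #(C x) → #(M + C x) + 2 ≤ Nat.card K → #((M + C x) \ C x) < #M →
      ∃ X : Finset G, (∀ x ∈ X, x ∈ K) ∧ 2 ≤ #X ∧ #(X + M) + 2 ≤ Nat.card K ∧
        #(X + M) < #X + #M := by
    intro x h1 h2 h3
    have hcX : #(-x +ᵥ C x) = #(C x) := card_vadd_finset _ _
    have hcXM : #((-x +ᵥ C x) + M) = #(M + C x) := by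
      rw [vadd_add_assoc, card_vadd_finset, add_comm]
    refine ⟨-x +ᵥ C x, ?_, by omega, by omega, ?_⟩
    · intro z hz
      obtain ⟨c, hc, rfl⟩ := mem_vadd_finset.mp hz
      have := (mem_filter.mp hc).2
      rwa [vadd_eq_add, neg_add_eq_sub]
    · have := hex x
      omega
  by_cases hlt0 : #(M + C 0) + 2 ≤ Nat.card K
  · exact main 0 (by omega) hlt0 (by omega)
  by_cases hlty : #(M + C y) + 2 ≤ Nat.card K
  · exact main y (by omega) hlty (by omega)
  exfalso
  -- Otherwise both sums M + C x nearly fill a coset of K. The half bounds then give |M| ≥ |K| - 1,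
  -- whereas two translates of M inside K give 2|M| - 1 ≤ |K|; this fails for |M| ≥ 3.
  have s0 := hsub K (by omega)
  have sy := hcoset K y
  have hC0 : #(C 0) = #(B.filter fun b => b ∈ K) := by simp [C]
  have hCy : #(C y) = #(B.filter fun b => b - y ∈ K) := rfl
  obtain ⟨m, hm, hm0⟩ : ∃ m ∈ M, m ≠ 0 := by
    obtain ⟨a, ha, b, hb, hab⟩ := one_lt_card.mp (show 1 < #M by omega)
    by_cases h : a = 0
    · exact ⟨b, hb, fun hb0 => hab (h.trans hb0.symm)⟩
    · exact ⟨a, ha, h⟩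
  have hint := hM m hm0
  have hun := card_union_add_card_inter M (m +ᵥ M)
  rw [card_vadd_finset] at hun
  have hle : #(M ∪ (m +ᵥ M)) ≤ Nat.card K := by
    rw [← card_filter_sub_mem K 0]
    refine card_le_card fun g hg => ?_
    rcases mem_union.mp hg with hg | hg
    · simpa using hMK g hg
    · obtain ⟨c, hc, rfl⟩ := mem_vadd_finset.mp hg
      simpa using K.add_mem (hMK m hm) (hMK c hc)
  omega

open scoped Classical in
/-- A **Vosper-type theorem**: a critical set `B` which fills every coset at most about half is
almost stable under some translation. -/
theorem exists_card_union_vadd_le [Fintype G] (B : Finset G) (h0 : 0 ∈ B) (hB2 : 2 ≤ #B)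
    (hgen : ∀ K : AddSubgroup G, (∀ b ∈ B, b ∈ K) → K = ⊤)
    (hcoset : ∀ (H : AddSubgroup G) x, 2 * #(B.filter fun b => b - x ∈ H) ≤ Nat.card H + 1)
    (hsub : ∀ H : AddSubgroup G, 2 ≤ Nat.card H →
      2 * #(B.filter fun b => b ∈ H) ≤ Nat.card H)
    (hBB2 : #(B + B) + 2 ≤ Nat.card G) (hBB : #(B + B) < #B + #B) :
    ∃ m : G, m ≠ 0 ∧ #(B ∪ (m +ᵥ B)) ≤ #B + 1 := by
  obtain ⟨M, hM0, -, hM2, hMB2, hMB, hMinter⟩ := exists_atom ⊤ B B (fun _ _ => trivial)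
    ⟨0, h0⟩ (fun _ _ => trivial) hB2 (by rwa [AddSubgroup.card_top]) hBB
  rw [AddSubgroup.card_top] at hMB2
  -- The aim is |M| = 2. A subgroup atom contradicts the half bound or generation; an atom with at
  -- least three points is refuted through an atom L of M itself.
  rcases coe_addSubgroup_or_card_inter_vadd_le_one M hM0 hMinter with ⟨H, hH⟩ | hM
  · exfalso
    have hcard : #M = Nat.card H := by
      rw [← SetLike.coe_sort_coe, hH]; simp
    by_cases hBH : ∃ b ∈ B, b ∉ H
    · have := card_add_card_le_card_subgroup_add B M H hH h0 (hcoset H)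
        (hsub H (by omega)) hBH
      omega
    · push Not at hBH
      have := hgen H hBH
      rw [this, AddSubgroup.card_top] at hcard
      have := card_le_card_add_right (s := M) ⟨0, h0⟩
      omega
  by_cases hM3 : 3 ≤ #M
  · exfalso
    obtain ⟨X, hXK, hX2, hXM2, hXM⟩ := exists_critical_in_closure B M h0 hM0 hB2 hgen hcoset hsub
      hM3 hMB2 hMB hM
    obtain ⟨L, hL0, hLK, hL2, hLM2, hLM, hLinter⟩ := exists_atom (AddSubgroup.closure (M : Set G))
      M X (fun b hb => AddSubgroup.subset_closure hb) ⟨0, hM0⟩ hXK hX2 hXM2 hXM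
    rcases coe_addSubgroup_or_card_inter_vadd_le_one L hL0 hLinter with ⟨H, hH⟩ | hL
    · have hmem : ∀ g, g ∈ L ↔ g ∈ H := fun g => by
        simpa using (Set.ext_iff.mp hH g).symm
      have hcard : #L = Nat.card H := by
        rw [← SetLike.coe_sort_coe, hH]; simp
      by_cases hMH : ∃ m ∈ M, m ∉ H
      · obtain ⟨m, hm, hmH⟩ := hMH
        have hdisj : Disjoint L (L + {m}) := by
          rw [disjoint_left]
          intro g hg hg'
          obtain ⟨l, hl, w, hw, rfl⟩ := mem_add.mp hg'
          rw [mem_singleton] at hw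
          subst hw
          rw [hmem] at hg hl
          exact hmH ((H.add_mem_cancel_left hl).mp hg)
        have h1 : #(L ∪ (L + {m})) ≤ #(L + M) := by
          refine card_le_card (union_subset (fun l hl => mem_add.mpr ⟨l, hl, 0, hM0, by simp⟩)
            (add_subset_add_left (singleton_subset_iff.mpr hm)))
        rw [card_union_of_disjoint hdisj, card_add_singleton] at h1
        have h2 := two_mul_card_le_card_add hM hL2
        omega
      · push Not at hMH
        have hle : AddSubgroup.closure (M : Set G) ≤ H := (AddSubgroup.closure_le H).mpr hMH
        have h1 : Nat.card (AddSubgroup.closure (M : Set G)) ≤ Nat.card H :=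
          AddSubgroup.card_le_of_le hle
        have h2 := card_le_card_add_right (s := L) ⟨0, hM0⟩
        omega
    · have h1 := two_mul_card_le_card_add hM hL2
      have h2 := two_mul_card_le_card_add hL hM2
      rw [add_comm M L] at h2
      have h3 := three_mul_card_le_card_add hM (L := L) (by omega)
      omega
  · have hM2' : #(M.erase 0) = 1 := by
      rw [card_erase_of_mem hM0]; omega
    obtain ⟨m, hm⟩ := card_eq_one.mp hM2'
    have hmM : m ∈ M.erase 0 := by rw [hm]; exact mem_singleton_self m
    obtain ⟨hm0, hmM⟩ := mem_erase.mp hmM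
    refine ⟨m, hm0, ?_⟩
    have : B ∪ (m +ᵥ B) ⊆ M + B :=
      union_subset (fun b hb => mem_add.mpr ⟨0, hM0, b, hb, by simp⟩) (vadd_finset_subset_add hmM)
    have := card_le_card this
    omega

end CriticalPairs

/-! ### From almost stable sets to arithmetic progressions -/

section Progressions

open Finset
open scoped Pointwise

open scoped Classical in
/-- A set that is almost stable under a translation is an arithmetic progression starting at `0`,
provided `0` is only trivially a sum of two of its elements and it contains no nontrivial coset. -/
theorem exists_forall_nsmul_mem {G : Type*} [AddCommGroup G] [Fintype G] [DecidableEq G] (B : Finset G)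
    (h0 : 0 ∈ B) (hzero : ∀ a ∈ B, ∀ b ∈ B, a + b = 0 → b = 0)
    (hcoset : ∀ (H : AddSubgroup G) x, 2 * #(B.filter fun b => b - x ∈ H) ≤ Nat.card H + 1)
    (m : G) (hm : m ≠ 0) (hBm : #(B ∪ (m +ᵥ B)) ≤ #B + 1) :
    ∃ h : G, h ≠ 0 ∧ ∀ j < #B, j • h ∈ B := by
  have hexit : ∀ b, ∃ j : ℕ, b + j • m ∉ B := by
    intro b
    by_contra! hcon
    have hsub : (univ.filter fun g => g - b ∈ AddSubgroup.zmultiples m) ⊆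
        B.filter fun g => g - b ∈ AddSubgroup.zmultiples m := by
      intro g hg
      have hg' := (mem_filter.mp hg).2
      obtain ⟨j, hj⟩ := mem_zmultiples_iff_mem_range_addOrderOf.mp hg' |> mem_image.mp
      refine mem_filter.mpr ⟨?_, hg'⟩
      have : g = b + j • m := by rw [hj.2]; abel
      rw [this]; exact hcon j
    have h1 := card_le_card hsub
    rw [card_filter_sub_mem] at h1
    have h2 := hcoset (AddSubgroup.zmultiples m) b
    have h3 : Nat.card (AddSubgroup.zmultiples m) ≠ 1 := by
      rw [Nat.card_zmultiples]
      simpa using hm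
    have h4 : 0 < Nat.card (AddSubgroup.zmultiples m) := Nat.card_pos
    omega
  -- Walking from any point of B by steps m leaves B, and there is only one exit point. So B is a
  -- single string ending just before s • m, the exit point of the walk from 0.
  have hE : #((m +ᵥ B) \ B) ≤ 1 := by
    have h1 := card_sdiff_add_card (m +ᵥ B) B
    rw [union_comm] at h1
    omega
  have hrun : ∀ b ∈ B, ∃ j : ℕ, 1 ≤ j ∧ (∀ i < j, b + i • m ∈ B) ∧
      b + j • m ∈ (m +ᵥ B) \ B := by
    intro b hb
    have hspec := Nat.find_spec (hexit b)
    have hmin : ∀ i < Nat.find (hexit b), b + i • m ∈ B := fun i hi =>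
      not_not.mp (Nat.find_min (hexit b) hi)
    have hpos : 1 ≤ Nat.find (hexit b) := by
      rw [Nat.one_le_iff_ne_zero]
      intro h
      rw [h] at hspec
      simp [hb] at hspec
    refine ⟨_, hpos, hmin, mem_sdiff.mpr ⟨mem_vadd_finset.mpr
      ⟨_, hmin (Nat.find (hexit b) - 1) (by omega), ?_⟩, hspec⟩⟩
    rw [vadd_eq_add, add_left_comm, ← succ_nsmul', Nat.sub_add_cancel hpos]
  obtain ⟨s, hs, hsB, hsE⟩ := hrun 0 h0
  rw [zero_add] at hsE
  have huniq : ∀ b ∈ B, ∃ j : ℕ, 1 ≤ j ∧ b = s • m - j • m ∧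
      ∀ i, 1 ≤ i → i ≤ j → s • m - i • m ∈ B := by
    intro b hb
    obtain ⟨j, hj1, hj2, hj3⟩ := hrun b hb
    have he := card_le_one.mp hE _ hj3 _ hsE
    refine ⟨j, hj1, by rw [← he]; abel, fun i hi hij => ?_⟩
    have := hj2 (j - i) (by omega)
    rw [← he]
    convert this using 1
    rw [add_sub_assoc, sub_eq_iff_eq_add.mpr]
    rw [← add_nsmul, Nat.sub_add_cancel hij]
  have hback : ∃ j : ℕ, s • m - (j + 1) • m ∉ B := by
    refine ⟨addOrderOf m - 1, ?_⟩
    rw [Nat.sub_add_cancel (addOrderOf_pos m), addOrderOf_nsmul_eq_zero, sub_zero]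
    exact (mem_sdiff.mp hsE).2
  obtain ⟨J, hJ, hJmin⟩ : ∃ J : ℕ, s • m - (J + 1) • m ∉ B ∧
      ∀ i, 1 ≤ i → i ≤ J → s • m - i • m ∈ B := by
    refine ⟨Nat.find hback, Nat.find_spec hback, fun i hi hiJ => ?_⟩
    have := not_not.mp (Nat.find_min hback (show i - 1 < Nat.find hback by omega))
    rwa [Nat.sub_add_cancel hi] at this
  have hle : ∀ b ∈ B, ∃ j : ℕ, 1 ≤ j ∧ j ≤ J ∧ b = s • m - j • m := by
    intro b hb
    obtain ⟨j, hj1, hj2, hj3⟩ := huniq b hb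
    refine ⟨j, hj1, ?_, hj2⟩
    by_contra hcon
    exact hJ (hj3 (J + 1) (by omega) (by omega))
  have hBJ : #B ≤ J := by
    have : B ⊆ (Icc 1 J).image fun i => s • m - i • m := fun b hb => by
      obtain ⟨j, h1, h2, h3⟩ := hle b hb
      exact mem_image.mpr ⟨j, mem_Icc.mpr ⟨h1, h2⟩, h3.symm⟩
    simpa using (card_le_card this).trans card_image_le
  have hsub : ∀ i ≤ s, s • m - i • m = (s - i) • m := fun i hi => by
    rw [sub_eq_iff_eq_add, ← add_nsmul, Nat.sub_add_cancel hi]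
  have hsJ : s ≤ J := by
    by_contra hcon
    refine hJ ?_
    have := hsB (s - (J + 1)) (by omega)
    rwa [zero_add, ← hsub _ (by omega)] at this
  -- If 0 were interior to the string, both m and -m would lie in B. Hence 0 is an end, and the step
  -- is m or -m accordingly.
  rcases Nat.lt_or_ge 1 s with hs1 | hs1
  · rcases Nat.lt_or_ge s J with hsJ' | hsJ'
    · exfalso
      have h1 := hJmin (s - 1) (by omega) (by omega)
      have h2 := hJmin (s + 1) (by omega) (by omega)
      have e1 : s • m - (s - 1) • m = m := by
        rw [sub_eq_iff_eq_add, ← succ_nsmul', Nat.sub_add_cancel hs]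
      have e2 : s • m - (s + 1) • m = -m := by
        rw [succ_nsmul]; abel
      rw [e1] at h1
      rw [e2] at h2
      exact hm (hzero _ h2 _ h1 (by abel))
    · refine ⟨m, hm, fun j hj => ?_⟩
      by_cases hj0 : j = 0
      · simpa [hj0] using h0
      · have := hJmin (s - j) (by omega) (by omega)
        rwa [hsub _ (by omega), Nat.sub_sub_self (by omega)] at this
  · have hs1 : s = 1 := by omega
    subst hs1
    refine ⟨-m, neg_ne_zero.mpr hm, fun j hj => ?_⟩
    have := hJmin (j + 1) (by omega) (by omega)
    rwa [sub_eq_iff_eq_add.mpr (show 1 • m = j • -m + (j + 1) • m by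
      rw [add_nsmul, smul_neg]; abel)] at this

theorem card_mul_card_sub_one_le_two_mul_sum {ι : Type*} (s : Finset ι) (f : ι → ℕ)
    (hf : Set.InjOn f s) : #s * (#s - 1) ≤ 2 * ∑ x ∈ s, f x := by
  have hset : ∀ t : Finset ℕ, ∑ i ∈ range #t, i ≤ ∑ x ∈ t, x := by
    intro t
    induction t using Finset.induction_on_max with
    | empty => simp
    -- The maximum of a set of n + 1 naturals is at least n.
    | insert a t hlt ih =>
      have ha : a ∉ t := fun h => lt_irrefl _ (hlt a h)
      rw [card_insert_of_notMem ha, sum_insert ha, sum_range_succ, add_comm]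
      refine add_le_add ?_ ih
      simpa using card_le_card (fun x hx => mem_range.mpr (hlt x hx) : t ⊆ range a)
  classical
  have h := hset (s.image f)
  rw [card_image_of_injOn hf, sum_image hf] at h
  have := sum_range_id_mul_two #s
  omega

end Progressions

/-! ### Heights and the lower bound -/

/-- A group of points of the torus `(ℤ/N)^{d+1}` with coordinate sum zero, no point of which with
representatives summing to `N` lies on a coordinate hyperplane. -/
structure HeightSystem (d N : ℕ) (G : Type*) [AddCommGroup G] where
  /-- The coordinates. -/
  coord : Fin (d + 1) → G →+ ZMod N
  sum_coord : ∀ x, ∑ i, coord i x = 0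
  eq_zero_of_coord : ∀ x, (∀ i, coord i x = 0) → x = 0
  clean : ∀ x, ∑ i, (coord i x).val = N → ∀ i, coord i x ≠ 0

namespace HeightSystem

open Finset
open scoped Pointwise

section Size

variable {d N : ℕ} {G : Type*} [AddCommGroup G] (S : HeightSystem d N G)

/-- The sum of the least nonnegative representatives of the coordinates. -/
def size (x : G) : ℕ := ∑ i, (S.coord i x).val

theorem size_add_le (x y : G) : S.size (x + y) ≤ S.size x + S.size y := by
  rw [size, size, size, ← sum_add_distrib]
  refine sum_le_sum fun i _ => ?_
  rw [map_add]
  exact ZMod.val_add_le _ _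

theorem size_zero : S.size 0 = 0 := by simp [size]

/-- The elements of height at most `j`. -/
def level [Fintype G] (j : ℕ) : Finset G := univ.filter fun x => S.size x ≤ j * N

theorem mem_level [Fintype G] {j : ℕ} {x : G} : x ∈ S.level j ↔ S.size x ≤ j * N := by simp [level]

theorem size_eq_zero {x : G} : S.size x = 0 ↔ x = 0 := by
  refine ⟨fun h => S.eq_zero_of_coord x fun i => ?_, fun h => h ▸ S.size_zero⟩
  have := (sum_eq_zero_iff.mp h) i (mem_univ i)
  exact (ZMod.val_eq_zero _).mp this

theorem zero_mem_level [Fintype G] (j : ℕ) : (0 : G) ∈ S.level j := by simp [mem_level, size_zero]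

theorem level_add_subset [Fintype G] [DecidableEq G] (j : ℕ) : S.level j + S.level 1 ⊆ S.level (j + 1) := by
  intro x hx
  obtain ⟨y, hy, z, hz, rfl⟩ := mem_add.mp hx
  rw [mem_level] at *
  have := S.size_add_le y z
  rw [add_mul]
  omega

theorem card_level_zero [Fintype G] : #(S.level 0) = 1 := by
  rw [card_eq_one]
  refine ⟨0, ?_⟩
  ext x
  simp [mem_level, size_eq_zero]

variable [NeZero N]

theorem dvd_size (x : G) : N ∣ S.size x := by
  rw [← ZMod.natCast_eq_zero_iff, size, Nat.cast_sum]
  simpa using S.sum_coord x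

theorem size_le (x : G) : S.size x ≤ d * N := by
  obtain ⟨t, ht⟩ := S.dvd_size x
  have hlt : S.size x < (d + 1) * N := by
    have : ∑ i, (S.coord i x).val < ∑ _i : Fin (d + 1), N :=
      sum_lt_sum_of_nonempty univ_nonempty fun i _ => ZMod.val_lt _
    simpa [size] using this
  rw [ht, mul_comm d]
  rw [ht, mul_comm (d + 1)] at hlt
  have := lt_of_mul_lt_mul_left hlt (Nat.zero_le N)
  exact Nat.mul_le_mul_left N (by omega)

theorem size_add_size_neg {x : G} (hx : ∀ i, S.coord i x ≠ 0) :
    S.size x + S.size (-x) = (d + 1) * N := by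
  rw [size, size, ← sum_add_distrib]
  rw [sum_congr rfl fun i _ => show _ = N from ?_]
  · simp
  · rw [map_neg, ZMod.neg_val, if_neg (hx i)]
    have := ZMod.val_lt (S.coord i x)
    omega

theorem size_add_size_neg_le {x : G} {l : Fin (d + 1)} (hx : S.coord l x = 0) :
    S.size x + S.size (-x) ≤ d * N := by
  have hle : ∀ i, (S.coord i x).val + (S.coord i (-x)).val ≤ N := by
    intro i
    rw [map_neg, ZMod.neg_val]
    have := ZMod.val_lt (S.coord i x)
    split_ifs <;> omega
  rw [size, size, ← sum_add_distrib, ← add_sum_erase _ _ (mem_univ l)]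
  have h0 : (S.coord l x).val + (S.coord l (-x)).val = 0 := by simp [hx]
  rw [h0, zero_add]
  refine (sum_le_card_nsmul _ _ N fun i _ => hle i).trans ?_
  simp [card_erase_of_mem]

/-- Here cleanness enters: no coordinate of x vanishes, so each coordinate and its negative have
residues adding up to N. -/
theorem size_neg {x : G} (hx : S.size x = N) : S.size (-x) = d * N := by
  have := S.size_add_size_neg (S.clean x hx)
  rw [hx, add_mul, one_mul] at this
  omega

variable [Fintype G]

theorem size_eq_of_mem_level_one {x : G} (hx : x ∈ S.level 1) (h0 : x ≠ 0) : S.size x = N := by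
  rw [mem_level, one_mul] at hx
  refine le_antisymm hx (Nat.le_of_dvd (Nat.pos_of_ne_zero ?_) (S.dvd_size x))
  rwa [Ne, size_eq_zero]

theorem level_top : S.level d = univ := by
  ext x
  simp [mem_level, S.size_le x]

theorem eq_zero_of_neg_mem_level {b : G} (hb : b ∈ S.level 1) {j : ℕ} (hj : j < d)
    (hneg : -b ∈ S.level j) : b = 0 := by
  by_contra h0
  have h1 := S.size_neg (S.size_eq_of_mem_level_one hb h0)
  rw [mem_level, h1] at hneg
  exact absurd hneg (not_le.mpr (Nat.mul_lt_mul_of_pos_right hj (NeZero.pos N)))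

variable [DecidableEq G]

theorem card_level_add {j : ℕ} (hj : j < d) :
    #(S.level j) + #(S.level 1) ≤ #(S.level j + S.level 1) + 1 := by
  refine card_add_card_le_card_add_of_unique_zero _ _ (S.zero_mem_level _) (S.zero_mem_level _) ?_
  intro a ha b hb hab
  refine S.eq_zero_of_neg_mem_level hb hj ?_
  rwa [← eq_neg_iff_add_eq_zero.mpr hab]

/-- Scherk's bound, iterated. An arbitrary starting level i is needed in the equality case, where
the levels above i bound level i from above. -/
theorem card_level_lower {k : ℕ} (hk : #(S.level 1) = k + 1) {i j : ℕ} (hij : i + j ≤ d) :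
    #(S.level i) + j * k ≤ #(S.level (i + j)) := by
  induction j with
  | zero => simp
  | succ j ih =>
    have h1 := ih (by omega)
    have h2 := S.card_level_add (j := i + j) (by omega)
    have h3 := card_le_card (S.level_add_subset (i + j))
    rw [add_mul, ← add_assoc]
    rw [← add_assoc]
    omega

theorem le_card {k : ℕ} (hk : #(S.level 1) = k + 1) : d * k + 1 ≤ Fintype.card G := by
  have := S.card_level_lower hk (i := 0) (j := d) (by omega)
  rw [card_level_zero, zero_add, level_top, card_univ] at this
  omega

end Size

/-! ### The equality case: height one is a progression -/

section Extremal

variable {d k : ℕ} {G : Type*} [AddCommGroup G] [Fintype G] (S : HeightSystem d (d * k + 1) G)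

theorem dvd_val_coord {H : AddSubgroup G} {q : ℕ} (hq : Nat.card H * q = d * k + 1) {h : G}
    (hh : h ∈ H) (i : Fin (d + 1)) : q ∣ (S.coord i h).val := by
  have h1 : Nat.card H • h = 0 := by
    have := card_nsmul_eq_zero' (x := (⟨h, hh⟩ : H))
    exact Subtype.ext_iff.mp this
  have h2 : ((Nat.card H * (S.coord i h).val : ℕ) : ZMod (d * k + 1)) = 0 := by
    have := congrArg (S.coord i) h1
    rw [map_nsmul, map_zero, nsmul_eq_mul] at this
    simpa using this
  rw [ZMod.natCast_eq_zero_iff] at h2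
  exact Nat.dvd_of_mul_dvd_mul_left Nat.card_pos (hq.dvd.trans h2)

theorem val_coord_modEq {H : AddSubgroup G} {q : ℕ} (hq : Nat.card H * q = d * k + 1) {a b : G}
    (hab : a - b ∈ H) (i : Fin (d + 1)) : (S.coord i a).val ≡ (S.coord i b).val [MOD q] := by
  have h1 : (S.coord i a).val ≡ (S.coord i (a - b)).val + (S.coord i b).val
      [MOD d * k + 1] := by
    rw [← ZMod.natCast_eq_natCast_iff]
    simp
  have h2 := h1.of_dvd (Dvd.intro_left _ hq)
  refine h2.trans ?_
  simpa only [zero_add] using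
    (Nat.modEq_zero_iff_dvd.mpr (S.dvd_val_coord hq hab i)).add_right (S.coord i b).val

variable [DecidableEq G]

theorem card_level (hk : #(S.level 1) = k + 1) (hG : Fintype.card G = d * k + 1) {j : ℕ}
    (hj : j ≤ d) : #(S.level j) = j * k + 1 := by
  have h1 := S.card_level_lower hk (i := 0) (j := j) (by omega)
  have h2 := S.card_level_lower hk (i := j) (j := d - j) (by omega)
  rw [Nat.add_sub_cancel' hj, level_top, card_univ, hG] at h2
  rw [card_level_zero, zero_add] at h1
  have h3 : j * k + (d - j) * k = d * k := by rw [← add_mul, Nat.add_sub_cancel' hj]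
  omega

theorem level_add (hk : #(S.level 1) = k + 1) (hG : Fintype.card G = d * k + 1) {j : ℕ}
    (hj : j < d) : S.level j + S.level 1 = S.level (j + 1) := by
  refine eq_of_subset_of_card_le (S.level_add_subset j) ?_
  have h1 := S.card_level_add hj
  rw [S.card_level hk hG hj.le, hk] at h1
  rw [S.card_level hk hG hj, Nat.succ_eq_add_one, add_mul]
  omega

theorem mem_of_level_one_subset (hk : #(S.level 1) = k + 1) (hG : Fintype.card G = d * k + 1)
    (K : AddSubgroup G) (hK : ∀ b ∈ S.level 1, b ∈ K) : K = ⊤ := by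
  have h : ∀ j ≤ d, ∀ x ∈ S.level j, x ∈ K := by
    intro j
    induction j with
    | zero =>
      intro _ x hx
      rw [mem_level, zero_mul, Nat.le_zero, size_eq_zero] at hx
      exact hx ▸ K.zero_mem
    | succ j ih =>
      intro hj x hx
      rw [← S.level_add hk hG (by omega)] at hx
      obtain ⟨y, hy, z, hz, rfl⟩ := mem_add.mp hx
      exact K.add_mem (ih (by omega) y hy) (hK z hz)
  refine eq_top_iff.mpr fun x _ => h d le_rfl x ?_
  rw [level_top]
  exact mem_univ x

/-- With a zero coordinate, the heights of x and -x add up to at most d. If x has height t + 1,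
tightness writes x = y + b with y in level t and b in level 1. Then -b = y - x has height below d,
so b = 0 and x drops to level t. -/
theorem coord_ne_zero (hk : #(S.level 1) = k + 1) (hG : Fintype.card G = d * k + 1)
    {x : G} (hx : x ≠ 0) (i : Fin (d + 1)) : S.coord i x ≠ 0 := by
  intro hi
  have hle := S.size_add_size_neg_le hi
  obtain ⟨t, ht⟩ := S.dvd_size x
  have htd : t ≤ d := by
    have := S.size_le x
    rw [ht, mul_comm _ t] at this
    exact Nat.le_of_mul_le_mul_right this (Nat.succ_pos _)
  obtain _ | t := t
  · exact hx (S.size_eq_zero.mp (by simpa using ht))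
  have hmem : x ∈ S.level (t + 1) := by rw [mem_level, ht, mul_comm]
  rw [← S.level_add hk hG (by omega)] at hmem
  obtain ⟨y, hy, b, hb, rfl⟩ := mem_add.mp hmem
  have hneg : S.size (-(y + b)) ≤ (d - (t + 1)) * (d * k + 1) := by
    rw [tsub_mul]
    rw [ht, mul_comm _ (t + 1)] at hle
    omega
  have hb0 : b = 0 := by
    refine S.eq_zero_of_neg_mem_level hb (j := d - 1) (by omega) ?_
    have h1 := S.size_add_le y (-(y + b))
    rw [mem_level] at hy ⊢
    have h2 : y + -(y + b) = -b := by abel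
    have h3 : d - 1 = t + (d - (t + 1)) := by omega
    rw [h2] at h1
    rw [h3, add_mul]
    omega
  rw [hb0, add_zero] at ht
  rw [mem_level, ht, mul_comm] at hy
  have := Nat.le_of_mul_le_mul_right hy (Nat.succ_pos _)
  omega

theorem coord_injective (hk : #(S.level 1) = k + 1) (hG : Fintype.card G = d * k + 1)
    (i : Fin (d + 1)) : Function.Injective (S.coord i) := by
  rw [injective_iff_map_eq_zero]
  intro x hx
  by_contra h
  exact S.coord_ne_zero hk hG h i hx

-- On a subgroup H of index q, each coordinate takes distinct values divisible by q, so over n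
-- elements its residues sum to at least q·n(n - 1)/2. All d + 1 coordinates together sum to at most
-- (n - 1)N, as 0 contributes nothing. Hence (d + 1)n ≤ 2|H|, and d ≥ 3 makes this 2n ≤ |H|.
open scoped Classical in
theorem two_mul_card_filter_mem_le (hd : 3 ≤ d) (hk : #(S.level 1) = k + 1)
    (hG : Fintype.card G = d * k + 1) (H : AddSubgroup G) (hH : 2 ≤ Nat.card H) :
    2 * #((S.level 1).filter fun b => b ∈ H) ≤ Nat.card H := by
  obtain ⟨C, hC⟩ : ∃ C, C = (S.level 1).filter fun b => b ∈ H := ⟨_, rfl⟩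
  rw [← hC]
  obtain ⟨q, hq⟩ : Nat.card H ∣ d * k + 1 := by
    rw [← hG, ← Nat.card_eq_fintype_card]; exact AddSubgroup.card_addSubgroup_dvd_card H
  have hq0 : 0 < q := Nat.pos_of_ne_zero fun h => by simp [h] at hq
  have h0 : (0 : G) ∈ C := hC ▸ mem_filter.mpr ⟨S.zero_mem_level 1, H.zero_mem⟩
  have hmem : ∀ c ∈ C, c ∈ H := fun c hc => (mem_filter.mp (hC ▸ hc)).2
  have hsum : ∑ i, ∑ c ∈ C, (S.coord i c).val ≤ (#C - 1) * (d * k + 1) := by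
    rw [sum_comm, ← add_sum_erase _ _ h0, ← card_erase_of_mem h0]
    simp only [map_zero, ZMod.val_zero, sum_const_zero, zero_add]
    refine sum_le_card_nsmul _ _ _ fun c hc => ?_
    have := (mem_filter.mp (hC ▸ (mem_erase.mp hc).2)).1
    simpa [mem_level, size] using this
  have hlow : ∀ i, q * (#C * (#C - 1)) ≤ 2 * ∑ c ∈ C, (S.coord i c).val := by
    intro i
    have h1 := card_mul_card_sub_one_le_two_mul_sum C (fun c => (S.coord i c).val / q) ?_
    · calc q * (#C * (#C - 1)) ≤ q * (2 * ∑ c ∈ C, (S.coord i c).val / q) :=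
          Nat.mul_le_mul_left q h1
        _ = 2 * ∑ c ∈ C, q * ((S.coord i c).val / q) := by rw [← mul_sum]; ring
        _ = 2 * ∑ c ∈ C, (S.coord i c).val := by
          congr 1
          exact sum_congr rfl fun c hc => Nat.mul_div_cancel' (S.dvd_val_coord hq.symm (hmem c hc) i)
    · intro a ha b hb hab
      have ha' := Nat.mul_div_cancel' (S.dvd_val_coord hq.symm (hmem a ha) i)
      have hb' := Nat.mul_div_cancel' (S.dvd_val_coord hq.symm (hmem b hb) i)
      refine S.coord_injective hk hG i (ZMod.val_injective _ ?_)
      rw [← ha', ← hb', show (S.coord i a).val / q = (S.coord i b).val / q from hab]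
  have htot : (d + 1) * (q * (#C * (#C - 1))) ≤ 2 * ((#C - 1) * (d * k + 1)) := by
    calc (d + 1) * (q * (#C * (#C - 1))) = ∑ _i : Fin (d + 1), q * (#C * (#C - 1)) := by simp
      _ ≤ ∑ i, 2 * ∑ c ∈ C, (S.coord i c).val := sum_le_sum fun i _ => hlow i
      _ ≤ _ := by rw [← mul_sum]; exact Nat.mul_le_mul_left 2 hsum
  rw [hq] at htot
  rcases Nat.lt_or_ge 1 #C with h1 | h1
  · have h2 : (q * (#C - 1)) * ((d + 1) * #C) ≤ (q * (#C - 1)) * (2 * Nat.card H) := by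
      nlinarith
    have h3 := Nat.le_of_mul_le_mul_left h2 (Nat.mul_pos hq0 (by omega))
    have h4 : 4 * #C ≤ (d + 1) * #C := Nat.mul_le_mul_right _ (by omega)
    omega
  · omega

open scoped Classical in
theorem two_mul_card_filter_sub_mem_le (hd : 3 ≤ d) (hk : #(S.level 1) = k + 1)
    (hG : Fintype.card G = d * k + 1) (H : AddSubgroup G) (x : G) :
    2 * #((S.level 1).filter fun b => b - x ∈ H) ≤ Nat.card H + 1 := by
  have hcard : 0 < Nat.card H := Nat.card_pos
  rcases Nat.lt_or_ge 1 (Nat.card H) with hH | hH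
  swap
  · have h1 : #((S.level 1).filter fun b => b - x ∈ H) ≤ Nat.card H := by
      rw [← card_filter_sub_mem H x]
      exact card_le_card (filter_subset_filter _ (subset_univ _))
    omega
  by_cases hx : x ∈ H
  · have h1 := S.two_mul_card_filter_mem_le hd hk hG H hH
    have h2 : ∀ b, b - x ∈ H ↔ b ∈ H := fun b => by
      rw [sub_eq_add_neg, H.add_mem_cancel_right (H.neg_mem hx)]
    simp only [h2]
    omega
  obtain ⟨C, hC⟩ : ∃ C, C = (S.level 1).filter fun b => b - x ∈ H := ⟨_, rfl⟩
  rw [← hC]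
  obtain ⟨q, hq⟩ : Nat.card H ∣ d * k + 1 := by
    rw [← hG, ← Nat.card_eq_fintype_card]; exact AddSubgroup.card_addSubgroup_dvd_card H
  have hq0 : 0 < q := Nat.pos_of_ne_zero fun h => by simp [h] at hq
  have hmem : ∀ c ∈ C, c - x ∈ H := fun c hc => by
    rw [hC] at hc; exact (mem_filter.mp hc).2
  have hne : ∀ c ∈ C, c ≠ 0 := fun c hc h => hx (by simpa [h] using hmem c hc)
  have hpos : ∀ i, ∀ c ∈ C, 1 ≤ (S.coord i c).val := fun i c hc => by
    rw [Nat.one_le_iff_ne_zero, Ne, ZMod.val_eq_zero]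
    exact S.coord_ne_zero hk hG (hne c hc) i
  have hsum : ∑ i, ∑ c ∈ C, (S.coord i c).val ≤ #C * (d * k + 1) := by
    rw [sum_comm]
    refine sum_le_card_nsmul _ _ _ fun c hc => ?_
    have := (mem_filter.mp (hC ▸ hc)).1
    simpa [mem_level, size] using this
  -- Off H the residues are positive, distinct and congruent mod q, so the quotients of val - 1 by q
  -- are distinct. The extra 1 per element makes the final inequality strict.
  have hlow : ∀ i, q * (#C * (#C - 1)) + 2 * #C ≤ 2 * ∑ c ∈ C, (S.coord i c).val := by
    intro i
    have h1 := card_mul_card_sub_one_le_two_mul_sum C (fun c => ((S.coord i c).val - 1) / q) ?_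
    · calc q * (#C * (#C - 1)) + 2 * #C
          ≤ q * (2 * ∑ c ∈ C, ((S.coord i c).val - 1) / q) + 2 * #C :=
          Nat.add_le_add_right (Nat.mul_le_mul_left q h1) _
        _ = 2 * ∑ c ∈ C, (q * (((S.coord i c).val - 1) / q) + 1) := by
          rw [sum_add_distrib, ← mul_sum]; simp; ring
        _ ≤ 2 * ∑ c ∈ C, (S.coord i c).val := by
          refine Nat.mul_le_mul_left 2 (sum_le_sum fun c hc => ?_)
          have := Nat.mul_div_le ((S.coord i c).val - 1) q
          have := hpos i c hc
          omega
    · intro a ha b hb hab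
      have hab' : a - b ∈ H := by
        have := H.sub_mem (hmem a ha) (hmem b hb)
        simpa using this
      have hmod : (S.coord i a).val - 1 ≡ (S.coord i b).val - 1 [MOD q] := by
        refine Nat.ModEq.add_right_cancel' 1 ?_
        rw [Nat.sub_add_cancel (hpos i a ha), Nat.sub_add_cancel (hpos i b hb)]
        exact S.val_coord_modEq hq.symm hab' i
      have hab : ((S.coord i a).val - 1) / q = ((S.coord i b).val - 1) / q := hab
      refine S.coord_injective hk hG i (ZMod.val_injective _ ?_)
      have h1 := Nat.div_add_mod ((S.coord i a).val - 1) q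
      have h2 := Nat.div_add_mod ((S.coord i b).val - 1) q
      rw [hab, hmod] at h1
      have := hpos i a ha
      have := hpos i b hb
      omega
  have htot : (d + 1) * (q * (#C * (#C - 1)) + 2 * #C) ≤ 2 * (#C * (d * k + 1)) := by
    calc (d + 1) * (q * (#C * (#C - 1)) + 2 * #C)
        = ∑ _i : Fin (d + 1), (q * (#C * (#C - 1)) + 2 * #C) := by simp
      _ ≤ ∑ i, 2 * ∑ c ∈ C, (S.coord i c).val := sum_le_sum fun i _ => hlow i
      _ ≤ _ := by rw [← mul_sum]; exact Nat.mul_le_mul_left 2 hsum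
  rw [hq] at htot
  rcases Nat.eq_zero_or_pos #C with h1 | h1
  · omega
  · have h2 : #C * ((d + 1) * (q * (#C - 1) + 2)) ≤ #C * (2 * (Nat.card H * q)) := by
      nlinarith
    have h3 := Nat.le_of_mul_le_mul_left h2 h1
    have h4 : 4 * (q * (#C - 1) + 2) ≤ (d + 1) * (q * (#C - 1) + 2) :=
      Nat.mul_le_mul_right _ (by omega)
    have h5 : q * (2 * (#C - 1)) < q * Nat.card H := by nlinarith
    have := Nat.lt_of_mul_lt_mul_left h5
    omega

/-- In the extremal case the elements of height one form an arithmetic progression. -/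
theorem exists_size_nsmul_eq (hd : 3 ≤ d) (hk1 : 1 ≤ k) (hk : #(S.level 1) = k + 1)
    (hG : Fintype.card G = d * k + 1) :
    ∃ h : G, ∀ j, 1 ≤ j → j ≤ k → S.size (j • h) = d * k + 1 := by
  have h0 := S.zero_mem_level 1
  have hzero : ∀ a ∈ S.level 1, ∀ b ∈ S.level 1, a + b = 0 → b = 0 := fun a ha b hb hab =>
    S.eq_zero_of_neg_mem_level hb (j := 1) (by omega) (by rwa [← eq_neg_iff_add_eq_zero.mpr hab])
  obtain ⟨h, hne, hh⟩ : ∃ h : G, h ≠ 0 ∧ ∀ j < #(S.level 1), j • h ∈ S.level 1 := by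
    -- The Vosper step needs 2k + 3 ≤ dk + 1, which d ≥ 3 guarantees only for k ≥ 2. For k = 1 two
    -- elements are trivially a progression.
    rcases Nat.lt_or_ge 1 k with hk2 | hk2
    · have h2 : S.level 1 + S.level 1 = S.level 2 := S.level_add hk hG (by omega)
      have h2c := S.card_level hk hG (j := 2) (by omega)
      have hdk : 3 * k ≤ d * k := Nat.mul_le_mul_right k hd
      obtain ⟨m, hm, hmB⟩ := exists_card_union_vadd_le (S.level 1) h0 (by omega)
        (S.mem_of_level_one_subset hk hG) (S.two_mul_card_filter_sub_mem_le hd hk hG)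
        (S.two_mul_card_filter_mem_le hd hk hG)
        (by rw [h2, h2c, Nat.card_eq_fintype_card, hG]; omega)
        (by rw [h2, h2c]; omega)
      exact exists_forall_nsmul_mem (S.level 1) h0 hzero
        (S.two_mul_card_filter_sub_mem_le hd hk hG) m hm hmB
    · obtain ⟨a, ha, hne⟩ := exists_mem_ne (show 1 < #(S.level 1) by omega) 0
      refine ⟨a, hne, fun j hj => ?_⟩
      obtain rfl | rfl : j = 0 ∨ j = 1 := by omega
      · simpa using h0
      · simpa using ha
  refine ⟨h, fun j hj1 hjk => S.size_eq_of_mem_level_one (hh j (by omega)) fun hj0 => hne ?_⟩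
  refine hzero _ (hh (j - 1) (by omega)) h (by simpa using hh 1 (by omega)) ?_
  rw [← succ_nsmul, Nat.sub_add_cancel hj1, hj0]

end Extremal

end HeightSystem

/-! ### Coordinates of the last term of the progression -/

namespace HeightSystem

open Finset

section Arithmetic

variable {d N : ℕ} {G : Type*} [AddCommGroup G] (S : HeightSystem d N G) [NeZero N]

theorem val_coord_nsmul (j : ℕ) (x : G) (i : Fin (d + 1)) :
    (S.coord i (j • x)).val = j * (S.coord i x).val % N := by
  rw [map_nsmul, nsmul_eq_mul, ← ZMod.val_natCast]
  simp

/-- Converts heights of multiples into sums of floors of the coordinates. -/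
theorem sum_div_add_size_nsmul (j : ℕ) (x : G) :
    N * ∑ i, j * (S.coord i x).val / N + S.size (j • x) = j * S.size x := by
  rw [size, size, mul_sum, mul_sum, ← sum_add_distrib]
  refine sum_congr rfl fun i _ => ?_
  rw [val_coord_nsmul, Nat.div_add_mod]

end Arithmetic

variable {d k : ℕ} {G : Type*} [AddCommGroup G] (S : HeightSystem d (d * k + 1) G)

theorem val_coord_le_of_size_nsmul {g : G} (hg : S.size g = d * k + 1)
    (hdg : S.size (d • g) = d * (d * k + 1)) (hd : 0 < d) (i : Fin (d + 1)) :
    (S.coord i g).val ≤ k := by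
  have h := S.sum_div_add_size_nsmul d g
  rw [hg, hdg] at h
  have h0 : ∑ i, d * (S.coord i g).val / (d * k + 1) = 0 := by
    have : (d * k + 1) * ∑ i, d * (S.coord i g).val / (d * k + 1) = 0 := by omega
    simpa using this
  have hi := sum_eq_zero_iff.mp h0 i (mem_univ i)
  rw [Nat.div_eq_zero_iff] at hi
  have hlt : d * (S.coord i g).val ≤ d * k := by omega
  exact Nat.le_of_mul_le_mul_left hlt hd

/-- If the elements `h, 2h, …, kh` all have height one, the coordinates of `kh` are
`k, …, k, 1` up to order. -/
theorem exists_coord_eq [Fintype G] (hd : 2 ≤ d) (hk : 1 ≤ k) (hG : Fintype.card G = d * k + 1)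
    (h : G) (hh : ∀ j, 1 ≤ j → j ≤ k → S.size (j • h) = d * k + 1) :
    ∃ (g : G) (i₀ : Fin (d + 1)), S.size g = d * k + 1 ∧ (S.coord i₀ g).val = 1 ∧
      ∀ i, i ≠ i₀ → (S.coord i g).val = k := by
  have hN : (d * k + 1) • h = 0 := by rw [← hG, card_nsmul_eq_zero]
  -- Since (dk + 1)h = 0, one has d g = -h. Thus (dm + 1)g = (k - m)h has height 1 and d(m + 1)g =
  -- -(m + 1)h has height d.
  obtain ⟨g, hg⟩ : ∃ g, g = k • h := ⟨_, rfl⟩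
  have hgs : S.size g = d * k + 1 := hg ▸ hh k hk le_rfl
  have hone : ∀ m < k, S.size ((d * m + 1) • g) = d * k + 1 := by
    intro m hm
    have : (d * m + 1) • g = (k - m) • h := by
      rw [hg, ← mul_nsmul']
      have e : (d * m + 1) * k = (k - m) + m * (d * k + 1) := by
        obtain ⟨c, rfl⟩ := Nat.exists_eq_add_of_lt hm
        rw [show m + c + 1 - m = c + 1 by omega]
        ring
      rw [e, add_nsmul, mul_nsmul', hN, nsmul_zero, add_zero]
    rw [this]
    exact hh _ (by omega) (by omega)
  have htop : ∀ m < k, S.size ((d * (m + 1)) • g) = d * (d * k + 1) := by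
    intro m hm
    have : (d * (m + 1)) • g = -((m + 1) • h) := by
      rw [eq_neg_iff_add_eq_zero, hg, ← mul_nsmul', ← add_nsmul,
        show d * (m + 1) * k + (m + 1) = (m + 1) * (d * k + 1) by ring, mul_nsmul', hN, nsmul_zero]
    rw [this]
    exact S.size_neg (hh _ (by omega) (by omega))
  obtain ⟨c, hc⟩ : ∃ c : Fin (d + 1) → ℕ, ∀ i, c i = (S.coord i g).val := ⟨_, fun _ => rfl⟩
  have hcsum : ∑ i, c i = d * k + 1 := by simpa only [hc, size] using hgs
  have hcle : ∀ i, c i ≤ k := fun i => by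
    rw [hc]
    exact S.val_coord_le_of_size_nsmul hgs (by simpa using htop 0 hk) (by omega) i
  obtain ⟨F, hF⟩ : ∃ F : ℕ → Fin (d + 1) → ℕ, ∀ j i, F j i = j * c i / (d * k + 1) :=
    ⟨_, fun _ _ => rfl⟩
  have hFsum : ∀ j, (d * k + 1) * ∑ i, F j i + S.size (j • g) = j * (d * k + 1) := fun j => by
    simpa only [hF, hc, hgs] using S.sum_div_add_size_nsmul j g
  have hF1 : ∀ m < k, ∑ i, F (d * m + 1) i = d * m := by
    intro m hm
    have := hFsum (d * m + 1)
    rw [hone m hm, add_mul (d * m), one_mul, mul_comm (d * m)] at this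
    exact Nat.eq_of_mul_eq_mul_left (show 0 < d * k + 1 by omega) (by omega)
  have hF2 : ∀ m < k, ∑ i, F (d * (m + 1)) i = d * m := by
    intro m hm
    have := hFsum (d * (m + 1))
    rw [htop m hm, mul_add d m 1, mul_one, add_mul (d * m), mul_comm (d * m)] at this
    rw [mul_add d m 1, mul_one]
    exact Nat.eq_of_mul_eq_mul_left (show 0 < d * k + 1 by omega) (by omega)
  have hFmono : ∀ {a b : ℕ}, a ≤ b → ∀ i, F a i ≤ F b i := fun hab i => by
    rw [hF, hF]
    exact Nat.div_le_div_right (Nat.mul_le_mul_right _ hab)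
  -- The floors are monotone in the multiplier and have the same sum dm at both ends, so each one is
  -- constant in between.
  have hFconst : ∀ m < k, ∀ i, F (d * m + 1) i = F (d * (m + 1)) i := by
    intro m hm i
    refine (sum_eq_sum_iff_of_le fun i _ => ?_).mp ((hF1 m hm).trans (hF2 m hm).symm) i (mem_univ i)
    exact hFmono (by rw [mul_add]; omega) i
  -- Superadditivity of the floor adds at least 1 over d + 1 steps, and constancy, with d ≥ 2,
  -- absorbs the surplus step. At m = k - 1 the floor is at least k - 1, too large for c i < k.
  have hclimb : ∀ i, 1 ≤ F (d + 1) i → c i = k := by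
    intro i hi
    have hind : ∀ m < k, m ≤ F (d * m + 1) i := by
      intro m
      induction m with
      | zero => intro _; exact Nat.zero_le _
      | succ m ih =>
        intro hm
        rw [hFconst (m + 1) hm i]
        have h1 := ih (by omega)
        have h2 : F (d * m + 1) i + F (d + 1) i ≤ F (d * m + 1 + (d + 1)) i := by
          rw [hF, hF, hF, add_mul (d * m + 1)]
          exact Nat.div_add_div_le_add_div
        have h3 : F (d * m + 1 + (d + 1)) i ≤ F (d * (m + 1 + 1)) i :=
          hFmono (by rw [mul_add, mul_add]; omega) i
        omega
    refine le_antisymm (hcle i) ?_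
    by_contra! hlt
    have h1 := hind (k - 1) (by omega)
    rw [hF, Nat.le_div_iff_mul_le (Nat.succ_pos _)] at h1
    obtain ⟨e, rfl⟩ : ∃ e, k = e + 1 := ⟨k - 1, by omega⟩
    rw [Nat.add_sub_cancel] at h1
    have h2 : (d * e + 1) * c i ≤ (d * e + 1) * e := Nat.mul_le_mul_left _ (by omega)
    obtain _ | e := e
    · have hz : F (d + 1) i = 0 := by
        rw [hF, show c i = 0 by omega]
        simp
      omega
    · nlinarith
  have hfin : ∀ i₀, (∀ i, i ≠ i₀ → c i = k) → c i₀ = 1 := by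
    intro i₀ hi
    rw [← add_sum_erase _ _ (mem_univ i₀),
      sum_congr rfl fun i hi' => hi i (mem_erase.mp hi').1] at hcsum
    simp only [sum_const, card_erase_of_mem (mem_univ i₀), card_univ, Fintype.card_fin,
      smul_eq_mul, Nat.add_sub_cancel] at hcsum
    omega
  suffices hex : ∃ i₀, ∀ i, i ≠ i₀ → c i = k by
    obtain ⟨i₀, hi₀⟩ := hex
    exact ⟨g, i₀, hgs, (hc i₀).symm.trans (hfin i₀ hi₀), fun i hi => (hc i).symm.trans (hi₀ i hi)⟩
  rcases Nat.lt_or_ge 1 k with hk2 | hk2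
  -- The d + 1 floors are 0 or 1 and sum to d, so exactly one of them vanishes.
  · have hsum : ∑ i, F (d + 1) i = d := by simpa using hF1 1 hk2
    have hle1 : ∀ i, F (d + 1) i ≤ 1 := by
      intro i
      rw [hF, ← Nat.lt_succ_iff, Nat.div_lt_iff_lt_mul (Nat.succ_pos _)]
      have : (d + 1) * c i ≤ (d + 1) * k := Nat.mul_le_mul_left _ (hcle i)
      nlinarith
    obtain ⟨i₀, hi₀⟩ : ∃ i₀, F (d + 1) i₀ = 0 := by
      by_contra! hne
      have : ∑ _i : Fin (d + 1), 1 ≤ ∑ i, F (d + 1) i :=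
        sum_le_sum fun i _ => Nat.one_le_iff_ne_zero.mpr (hne i)
      rw [hsum] at this
      simp at this
    refine ⟨i₀, fun i hi => hclimb i ?_⟩
    by_contra hcon
    have h1 := add_sum_erase univ (F (d + 1)) (mem_univ i₀)
    have h2 := add_sum_erase (univ.erase i₀) (F (d + 1)) (mem_erase.mpr ⟨hi, mem_univ i⟩)
    have h3 : ∑ x ∈ (univ.erase i₀).erase i, F (d + 1) x ≤ #((univ.erase i₀).erase i) • 1 :=
      sum_le_card_nsmul _ _ _ fun x _ => hle1 x
    rw [card_erase_of_mem (mem_erase.mpr ⟨hi, mem_univ i⟩), card_erase_of_mem (mem_univ i₀),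
      card_univ, Fintype.card_fin, smul_eq_mul] at h3
    omega
  · obtain rfl : k = 1 := by omega
    refine ⟨0, fun i _ => le_antisymm (hcle i) ?_⟩
    rw [Nat.one_le_iff_ne_zero, hc, Ne, ZMod.val_eq_zero]
    exact S.clean g hgs i

end HeightSystem

/-! ### Volume of simplices and of affine images -/

section Volume

/-- The corner simplex `{x | 0 ≤ x, ∑ x_i ≤ r}` of size `r`. -/
def cornerSimplex (d : ℕ) (r : ℝ) : Set (Fin d → ℝ) := {x | (∀ i, 0 ≤ x i) ∧ ∑ i, x i ≤ r}

theorem measurableSet_cornerSimplex (d : ℕ) (r : ℝ) : MeasurableSet (cornerSimplex d r) := by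
  have h : cornerSimplex d r = (⋂ i, {x | 0 ≤ x i}) ∩ {x | ∑ i, x i ≤ r} := by
    ext x; simp [cornerSimplex]
  rw [h]
  exact (MeasurableSet.iInter fun i => measurableSet_le measurable_const (measurable_pi_apply i)).inter
    (measurableSet_le (Finset.measurable_sum _ fun i _ => measurable_pi_apply i) measurable_const)

/-- Slicing at first coordinate t leaves a corner simplex of size r - t, so the induction has to run
over all sizes. -/
theorem volume_cornerSimplex (d : ℕ) {r : ℝ} (hr : 0 ≤ r) :
    volume (cornerSimplex d r) = ENNReal.ofReal (r ^ d / (d ! : ℝ)) := by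
  induction d generalizing r with
  | zero =>
    have h : cornerSimplex 0 r = Set.univ := by
      ext x; simp [cornerSimplex, hr]
    rw [h, volume_pi, Measure.pi_of_empty (x := isEmptyElim)]
    simp
  | succ d ih =>
    obtain ⟨U, hU⟩ : ∃ U : Set (ℝ × (Fin d → ℝ)),
        U = {p | 0 ≤ p.1 ∧ (∀ i, 0 ≤ p.2 i) ∧ p.1 + ∑ i, p.2 i ≤ r} := ⟨_, rfl⟩
    have hpre : cornerSimplex (d + 1) r =
        MeasurableEquiv.piFinSuccAbove (fun _ : Fin (d + 1) => ℝ) 0 ⁻¹' U := by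
      ext x
      simp only [cornerSimplex, hU, Set.mem_preimage, Set.mem_ofPred_eq, Fin.forall_fin_succ,
        Fin.sum_univ_succ]
      simp [MeasurableEquiv.piFinSuccAbove, and_assoc, Fin.tail]
    have hmeas : MeasurableSet U := by
      have := measurableSet_cornerSimplex (d + 1) r
      rw [hpre] at this
      exact (MeasurableEquiv.measurableSet_preimage _).mp this
    have hslice : ∀ t : ℝ, volume (Prod.mk t ⁻¹' U) =
        (Set.Icc 0 r).indicator (fun t => ENNReal.ofReal ((r - t) ^ d / (d ! : ℝ))) t := by
      intro t
      by_cases ht : t ∈ Set.Icc 0 r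
      · rw [Set.indicator_of_mem ht, ← ih (sub_nonneg.mpr ht.2)]
        congr 1
        ext x
        simp only [hU, cornerSimplex, Set.mem_preimage, Set.mem_ofPred_eq, ht.1, true_and]
        rw [le_sub_iff_add_le']
      · rw [Set.indicator_of_notMem ht]
        have hemp : Prod.mk t ⁻¹' U = ∅ := by
          ext x
          simp only [hU, Set.mem_preimage, Set.mem_ofPred_eq, Set.mem_empty_iff_false, iff_false]
          rintro ⟨h1, h2, h3⟩
          have := Finset.sum_nonneg fun i (_ : i ∈ Finset.univ) => h2 i
          exact ht ⟨h1, by linarith⟩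
        rw [hemp, measure_empty]
    rw [hpre, (volume_preserving_piFinSuccAbove (fun _ : Fin (d + 1) => ℝ) 0).measure_preimage
      hmeas.nullMeasurableSet, Measure.volume_eq_prod, Measure.prod_apply hmeas]
    simp only [hslice]
    rw [lintegral_indicator measurableSet_Icc, ← ofReal_integral_eq_lintegral_ofReal]
    · congr 1
      rw [integral_Icc_eq_integral_Ioc, ← intervalIntegral.integral_of_le hr,
        intervalIntegral.integral_comp_sub_left (fun t => t ^ d / (d ! : ℝ)) r]
      simp only [sub_self, sub_zero, intervalIntegral.integral_div, integral_pow]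
      rw [Nat.factorial_succ]
      push_cast
      field_simp
      simp
    · exact (Continuous.integrableOn_Icc (by fun_prop))
    · refine (ae_restrict_iff' measurableSet_Icc).mpr (Filter.Eventually.of_forall fun t ht => ?_)
      have := sub_nonneg.mpr ht.2
      simp only [Pi.zero_apply]
      positivity

theorem volume_real_cornerSimplex (d : ℕ) : volume.real (cornerSimplex d 1) = 1 / (d ! : ℝ) := by
  rw [Measure.real, volume_cornerSimplex d zero_le_one, one_pow, ENNReal.toReal_ofReal (by positivity)]

theorem volume_real_image_integralAffineMap {d : ℕ} (M : Matrix (Fin d) (Fin d) ℤ) (u : Fin d → ℤ)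
    (Q : Set (Fin d → ℝ)) :
    volume.real (integralAffineMap M u '' Q) = |(M.det : ℝ)| * volume.real Q := by
  have h : integralAffineMap M u '' Q =
      (fun x => x + latticePoint u) ''
        (Matrix.toLin' (M.map (fun n : ℤ => (n : ℝ)))ᵀ '' Q) := by
    rw [Set.image_image]
    refine Set.image_congr fun x _ => ?_
    rw [integralAffineMap, Matrix.toLin'_apply, Matrix.mulVec_transpose]
  have hdet : (M.map (fun n : ℤ => (n : ℝ))).det = (M.det : ℝ) :=
    (Int.cast_det M).symm
  rw [h, Measure.real, Set.image_add_right, measure_preimage_add_right,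
    Measure.addHaar_image_linearMap, LinearMap.det_toLin', Matrix.det_transpose, hdet,
    ENNReal.toReal_mul, ENNReal.toReal_ofReal (abs_nonneg _), Measure.real]

/-- `integralAffineMap` as a bundled affine map. -/
def integralAffineHom {d : ℕ} (M : Matrix (Fin d) (Fin d) ℤ) (u : Fin d → ℤ) :
    (Fin d → ℝ) →ᵃ[ℝ] (Fin d → ℝ) :=
  (Matrix.vecMulLinear (M.map (fun n : ℤ => (n : ℝ)))).toAffineMap +
    AffineMap.const ℝ _ (latticePoint u)

theorem coe_integralAffineHom {d : ℕ} (M : Matrix (Fin d) (Fin d) ℤ) (u : Fin d → ℤ) :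
    ⇑(integralAffineHom M u) = integralAffineMap M u := rfl

end Volume

/-! ### Barycentric coordinates and extreme points -/

section Barycentric

variable {ι E : Type*} [Fintype ι] [AddCommGroup E] [Module ℝ E] (b : AffineBasis ι ℝ E)

theorem AffineBasis.coord_sum_smul {w : ι → ℝ} (hw : ∑ i, w i = 1) (i : ι) :
    b.coord i (∑ j, w j • b j) = w i := by
  rw [← Finset.affineCombination_eq_linear_combination _ _ _ hw,
    b.coord_apply_combination_of_mem (Finset.mem_univ i) hw]

theorem AffineBasis.extremePoints_convexHull_range :
    (convexHull ℝ (Set.range b)).extremePoints ℝ = Set.range b := by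
  classical
  refine Set.Subset.antisymm extremePoints_convexHull_subset ?_
  rintro _ ⟨j, rfl⟩
  rw [mem_extremePoints]
  refine ⟨subset_convexHull ℝ _ ⟨j, rfl⟩, ?_⟩
  have key : ∀ x ∈ convexHull ℝ (Set.range b), (∀ i, i ≠ j → b.coord i x = 0) → x = b j := by
    intro x _ hx
    refine b.ext_elem fun i => ?_
    have hsum := b.sum_coord_apply_eq_one x
    rw [Finset.sum_eq_single j (fun i _ hi => hx i hi) (by simp)] at hsum
    rw [b.coord_apply]
    split_ifs with hij
    · rw [hij, hsum]
    · exact hx i hij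
  rintro x hx y hy ⟨s, t, hs, ht, hst, hxy⟩
  have hx' := hx
  have hy' := hy
  rw [b.convexHull_eq_nonneg_coord] at hx' hy'
  have hcoord : ∀ i, i ≠ j → s * b.coord i x + t * b.coord i y = 0 := by
    intro i hi
    have h1 := Convex.combo_affine_apply (x := x) (y := y) (f := b.coord i) hst
    rw [hxy, b.coord_apply, if_neg hi] at h1
    simpa using h1.symm
  refine ⟨key x hx fun i hi => ?_, key y hy fun i hi => ?_⟩
  · have := hcoord i hi
    have h1 := mul_nonneg hs.le (hx' i)
    have h2 := mul_nonneg ht.le (hy' i)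
    have h3 : s * b.coord i x = 0 := by linarith
    exact (mul_eq_zero.mp h3).resolve_left hs.ne'
  · have := hcoord i hi
    have h1 := mul_nonneg hs.le (hx' i)
    have h2 := mul_nonneg ht.le (hy' i)
    have h3 : t * b.coord i y = 0 := by linarith
    exact (mul_eq_zero.mp h3).resolve_left ht.ne'

end Barycentric

/-! ### Order of the kernel modulo the determinant -/

section ModularKernel

variable {n : ℕ}

/-- The solutions of `x · A = 0` modulo `N`. -/
def modularKernel (A : Matrix (Fin n) (Fin n) ℤ) (N : ℕ) : AddSubgroup (Fin n → ZMod N) :=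
  (Matrix.vecMulLinear (A.map (fun a : ℤ => (a : ZMod N)))).toAddMonoidHom.ker

theorem mem_modularKernel {A : Matrix (Fin n) (Fin n) ℤ} {N : ℕ} {x : Fin n → ZMod N} :
    x ∈ modularKernel A N ↔ x ᵥ* A.map (fun a : ℤ => (a : ZMod N)) = 0 := Iff.rfl

theorem intCast_comp_mem_modularKernel {A : Matrix (Fin n) (Fin n) ℤ} {N : ℕ} {x : Fin n → ℤ} :
    (fun i => (x i : ZMod N)) ∈ modularKernel A N ↔ ∃ y : Fin n → ℤ, x ᵥ* A = (N : ℤ) • y := by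
  have h : ∀ j, ((fun i => (x i : ZMod N)) ᵥ* A.map (fun a : ℤ => (a : ZMod N))) j =
      (((x ᵥ* A) j : ℤ) : ZMod N) := by
    intro j
    simp [Matrix.vecMul, dotProduct]
  rw [mem_modularKernel, funext_iff]
  simp only [h, Pi.zero_apply, ZMod.intCast_zmod_eq_zero_iff_dvd]
  constructor
  · intro hd
    choose y hy using hd
    exact ⟨y, funext fun j => by rw [hy j]; simp⟩
  · rintro ⟨y, hy⟩ j
    exact ⟨y j, by rw [hy]; simp⟩

/-- A solution of x · A = N y is x = ± y · adj A. So the kernel lies in the image of y ↦ y · adj A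
mod N, which factors through the quotient of ℤⁿ by the row lattice of A, a group of order |det A|.
-/
theorem card_modularKernel_le (A : Matrix (Fin n) (Fin n) ℤ) (hA : A.det ≠ 0) :
    Nat.card (modularKernel A A.det.natAbs) ≤ A.det.natAbs := by
  obtain ⟨N, hN⟩ : ∃ N, N = A.det.natAbs := ⟨_, rfl⟩
  have hN0 : NeZero N := ⟨by rw [hN]; exact Int.natAbs_ne_zero.mpr hA⟩
  rw [← hN]
  obtain ⟨f, hf⟩ : ∃ f, f = Matrix.toLin' Aᵀ := ⟨_, rfl⟩
  have hfapp : ∀ y, f y = y ᵥ* A := fun y => by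
    rw [hf, Matrix.toLin'_apply, Matrix.mulVec_transpose]
  have hinj : Function.Injective f := by
    rw [injective_iff_map_eq_zero]
    intro y hy
    rw [hfapp] at hy
    exact Matrix.eq_zero_of_vecMul_eq_zero hA hy
  have hindex : f.range.toAddSubgroup.index = N := by
    have h := Submodule.natAbs_det_equiv f.range (LinearEquiv.ofInjective f hinj)
    have h2 : f.range.subtype ∘ₗ
        AddMonoidHom.toIntLinearMap ((LinearEquiv.ofInjective f hinj : _ →+ f.range)) = f := by
      ext; rfl
    rw [h2, hf, LinearMap.det_toLin', Matrix.det_transpose, ← hN] at h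
    rw [h, hf]
    rfl
  obtain ⟨ψ, hψ⟩ : ∃ ψ : (Fin n → ℤ) →+ (Fin n → ZMod N),
      ∀ y i, ψ y i = (((y ᵥ* A.adjugate) i : ℤ) : ZMod N) := by
    refine ⟨{ toFun := fun y i => (((y ᵥ* A.adjugate) i : ℤ) : ZMod N), map_zero' := ?_,
              map_add' := ?_ }, fun _ _ => rfl⟩
    · ext i; simp
    · intro x y; ext i; simp [Matrix.add_vecMul]
  have hdetN : ((A.det : ℤ) : ZMod N) = 0 := by
    rw [ZMod.intCast_zmod_eq_zero_iff_dvd, hN]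
    exact Int.natAbs_dvd.mpr dvd_rfl
  have hker : f.range.toAddSubgroup ≤ ψ.ker := by
    rintro _ ⟨y, rfl⟩
    rw [AddMonoidHom.mem_ker]
    ext i
    rw [hψ, hfapp, Matrix.vecMul_vecMul, Matrix.mul_adjugate, Matrix.vecMul_smul,
      Matrix.vecMul_one]
    simp [hdetN]
  have hrange : modularKernel A N ≤ ψ.range := by
    intro x hx
    have hx' : (fun i => (((x i).val : ℤ) : ZMod N)) = x := by ext i; simp
    rw [← hx', intCast_comp_mem_modularKernel] at hx
    obtain ⟨y, hy⟩ := hx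
    have h1 : A.det • (fun i => ((x i).val : ℤ)) = (N : ℤ) • (y ᵥ* A.adjugate) := by
      rw [← Matrix.smul_vecMul, ← hy, Matrix.vecMul_vecMul, Matrix.mul_adjugate,
        Matrix.vecMul_smul, Matrix.vecMul_one]
    obtain ⟨s, hs⟩ : ∃ s : ℤ, s * A.det = N := by
      rw [hN]
      rcases Int.natAbs_eq A.det with h | h
      · exact ⟨1, by omega⟩
      · exact ⟨-1, by omega⟩
    have hNz : (N : ℤ) ≠ 0 := by exact_mod_cast hN0.out
    refine ⟨s • y, ?_⟩
    ext i
    have h2 := congrFun h1 i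
    simp only [Pi.smul_apply, smul_eq_mul] at h2
    rw [hψ, Matrix.smul_vecMul, ← hx']
    have h3 : (s • (y ᵥ* A.adjugate)) i = ((x i).val : ℤ) := by
      refine mul_left_cancel₀ hNz ?_
      rw [Pi.smul_apply, smul_eq_mul, mul_left_comm, ← h2, ← mul_assoc, hs]
    rw [h3]
  have hidx : ψ.ker.index ≤ N := by
    refine (Nat.le_of_dvd ?_ (AddSubgroup.index_dvd_of_le hker)).trans_eq hindex
    rw [hindex]
    exact Nat.pos_of_ne_zero hN0.out
  rw [AddSubgroup.index_ker] at hidx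
  exact (AddSubgroup.card_le_of_le hrange).trans hidx

end ModularKernel

/-! ### Lattice simplices: vertex matrix and normalized volume -/

section LatticeSimplex

variable {d : ℕ}

/-- The rows are the vertices in homogeneous coordinates. -/
def vertexMatrix (v : Fin (d + 1) → Fin d → ℤ) : Matrix (Fin (d + 1)) (Fin (d + 1)) ℤ :=
  Matrix.of fun i => Fin.cons 1 (v i)

/-- The rows are the edge vectors at the first vertex. -/
def edgeMatrix (v : Fin (d + 1) → Fin d → ℤ) : Matrix (Fin d) (Fin d) ℤ :=
  Matrix.of fun i => v i.succ - v 0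

theorem det_vertexMatrix (v : Fin (d + 1) → Fin d → ℤ) :
    (vertexMatrix v).det = (edgeMatrix v).det := by
  obtain ⟨B, hB⟩ : ∃ B : Matrix (Fin (d + 1)) (Fin (d + 1)) ℤ,
      B = Matrix.of (Fin.cons (Fin.cons 1 (v 0)) fun i => Fin.cons 0 (v i.succ - v 0)) := ⟨_, rfl⟩
  have h1 : (vertexMatrix v).det = B.det := by
    refine Matrix.det_eq_of_forall_row_eq_smul_add_const (Fin.cons 0 fun _ => 1) 0 rfl ?_
    intro i j
    refine Fin.cases ?_ (fun i => ?_) i <;> refine Fin.cases ?_ (fun j => ?_) j <;>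
      simp [vertexMatrix, hB]
  rw [h1, Matrix.det_succ_column_zero, Fin.sum_univ_succ]
  have h2 : B.submatrix (Fin.succAbove 0) Fin.succ = edgeMatrix v := by
    ext i j
    simp [hB, edgeMatrix]
  rw [h2]
  simp [hB]

theorem vecMul_vertexMatrix_zero (v : Fin (d + 1) → Fin d → ℤ) (c : Fin (d + 1) → ℤ) :
    (c ᵥ* vertexMatrix v) 0 = ∑ i, c i := by
  simp [Matrix.vecMul, dotProduct, vertexMatrix]

theorem vecMul_vertexMatrix_succ (v : Fin (d + 1) → Fin d → ℤ) (c : Fin (d + 1) → ℤ) (j : Fin d) :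
    (c ᵥ* vertexMatrix v) j.succ = ∑ i, c i * v i j := by
  simp [Matrix.vecMul, dotProduct, vertexMatrix]

variable {v : Fin (d + 1) → Fin d → ℤ}

/-- The vertices of a lattice simplex as an affine basis. -/
def vertexBasis
    (hv : AffineIndependent ℝ fun j => latticePoint (v j)) : AffineBasis (Fin (d + 1)) ℝ (Fin d → ℝ) :=
  ⟨fun j => latticePoint (v j), hv, by
    rw [hv.affineSpan_eq_top_iff_card_eq_finrank_add_one]; simp⟩

theorem coe_vertexBasis
    (hv : AffineIndependent ℝ fun j => latticePoint (v j)) : ⇑(vertexBasis hv) = fun j => latticePoint (v j) := rfl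

theorem det_vertexMatrix_ne_zero
    (hv : AffineIndependent ℝ fun j => latticePoint (v j)) : (vertexMatrix v).det ≠ 0 := by
  intro hdet
  obtain ⟨c, hc0, hc⟩ := Matrix.exists_vecMul_eq_zero_iff.mpr hdet
  refine hc0 (funext fun i => ?_)
  have h := hv.eq_zero_of_sum_eq_zero (s := Finset.univ) (w := fun i => (c i : ℝ)) ?_ ?_ i
    (Finset.mem_univ i)
  · exact_mod_cast h
  · have := congrFun hc 0
    rw [vecMul_vertexMatrix_zero] at this
    exact_mod_cast this
  · ext j
    have := congrFun hc j.succ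
    rw [vecMul_vertexMatrix_succ, Pi.zero_apply] at this
    simp only [Finset.sum_apply, Pi.smul_apply, latticePoint, smul_eq_mul, Pi.zero_apply]
    exact_mod_cast this

/-- The normalized volume of the simplex with vertices `v`. -/
def normalizedVolume (v : Fin (d + 1) → Fin d → ℤ) : ℕ := (vertexMatrix v).det.natAbs

theorem normalizedVolume_pos
    (hv : AffineIndependent ℝ fun j => latticePoint (v j)) : 0 < normalizedVolume v :=
  Int.natAbs_pos.mpr (det_vertexMatrix_ne_zero hv)

theorem coord_latticePoint (hv : AffineIndependent ℝ fun j => latticePoint (v j))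
    {c : Fin (d + 1) → ℤ} {z : Fin d → ℤ}
    (h : c ᵥ* vertexMatrix v = (normalizedVolume v : ℤ) • Fin.cons 1 z) (i : Fin (d + 1)) :
    (vertexBasis hv).coord i (latticePoint z) = c i / normalizedVolume v := by
  have hN : (normalizedVolume v : ℝ) ≠ 0 := by exact_mod_cast (normalizedVolume_pos hv).ne'
  have hz : latticePoint z = ∑ j, ((c j : ℝ) / normalizedVolume v) • (vertexBasis hv) j := by
    ext j
    have := congrFun h j.succ
    rw [vecMul_vertexMatrix_succ] at this
    simp only [Pi.smul_apply, Fin.cons_succ, smul_eq_mul] at this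
    simp only [coe_vertexBasis, Finset.sum_apply, Pi.smul_apply, latticePoint, smul_eq_mul,
      div_mul_eq_mul_div]
    rw [← Finset.sum_div, eq_div_iff hN]
    exact_mod_cast (mul_comm _ _).trans this.symm
  rw [hz]
  refine AffineBasis.coord_sum_smul _ ?_ i
  have := congrFun h 0
  rw [vecMul_vertexMatrix_zero] at this
  simp only [Pi.smul_apply, Fin.cons_zero, smul_eq_mul, mul_one] at this
  rw [← Finset.sum_div, div_eq_one_iff_eq hN]
  exact_mod_cast this

/-- The adjugate gives integral barycentric numerators over the common denominator N; the sign of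
the determinant goes into c. -/
theorem exists_vecMul_vertexMatrix (v : Fin (d + 1) → Fin d → ℤ) (y : Fin (d + 1) → ℤ) :
    ∃ c : Fin (d + 1) → ℤ, c ᵥ* vertexMatrix v = (normalizedVolume v : ℤ) • y := by
  have h : (y ᵥ* (vertexMatrix v).adjugate) ᵥ* vertexMatrix v = (vertexMatrix v).det • y := by
    rw [Matrix.vecMul_vecMul, Matrix.adjugate_mul, Matrix.vecMul_smul, Matrix.vecMul_one]
  rcases Int.natAbs_eq (vertexMatrix v).det with hdet | hdet
  · exact ⟨_, h.trans (by rw [hdet]; simp [normalizedVolume])⟩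
  · refine ⟨-(y ᵥ* (vertexMatrix v).adjugate), ?_⟩
    rw [Matrix.neg_vecMul, h, ← neg_smul]
    congr 1
    rw [normalizedVolume]
    omega

theorem volume_real_lattice_simplex
    (hv : AffineIndependent ℝ fun j => latticePoint (v j)) :
    volume.real (convexHull ℝ (Set.range fun j => latticePoint (v j))) =
      normalizedVolume v / (d ! : ℝ) := by
  have himg : convexHull ℝ (Set.range fun j => latticePoint (v j)) =
      integralAffineMap (edgeMatrix v) (v 0) '' cornerSimplex d 1 := by
    have happ : ∀ w : Fin (d + 1) → ℝ, ∑ i, w i = 1 →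
        integralAffineMap (edgeMatrix v) (v 0) (Fin.tail w) = ∑ i, w i • vertexBasis hv i := by
      intro w hw
      ext j
      rw [Fin.sum_univ_succ] at hw
      rw [Fin.sum_univ_succ]
      simp only [integralAffineMap, coe_vertexBasis, Pi.add_apply, Pi.smul_apply, latticePoint,
        Matrix.vecMul, dotProduct, Finset.sum_apply, smul_eq_mul, Fin.tail, edgeMatrix,
        Matrix.map_apply, Matrix.of_apply, Pi.sub_apply, Int.cast_sub, mul_sub,
        Finset.sum_sub_distrib]
      rw [← Finset.sum_mul, show w 0 = 1 - ∑ i : Fin d, w i.succ by linarith]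
      ring
    rw [← coe_vertexBasis hv, AffineBasis.convexHull_eq_nonneg_coord]
    ext x
    constructor
    · intro hx
      have hsum := (vertexBasis hv).sum_coord_apply_eq_one x
      refine ⟨Fin.tail fun i => (vertexBasis hv).coord i x, ⟨fun i => hx i.succ, ?_⟩, ?_⟩
      · rw [Fin.sum_univ_succ] at hsum
        have := hx 0
        simp only [Fin.tail]
        linarith
      · rw [happ _ hsum, AffineBasis.linear_combination_coord_eq_self]
    · rintro ⟨y, ⟨hy0, hy1⟩, rfl⟩ i
      have hsum : ∑ i, (Fin.cons (1 - ∑ i, y i) y : Fin (d + 1) → ℝ) i = 1 := by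
        rw [Fin.sum_univ_succ]; simp
      have := happ _ hsum
      rw [Fin.tail_cons] at this
      rw [this, AffineBasis.coord_sum_smul _ hsum]
      refine Fin.cases ?_ (fun i => ?_) i
      · simpa using hy1
      · simpa using hy0 i
  rw [himg, volume_real_image_integralAffineMap, volume_real_cornerSimplex, ← det_vertexMatrix,
    normalizedVolume, Nat.cast_natAbs, Int.cast_abs, mul_one_div]

end LatticeSimplex

/-! ### The height system of a clean simplex -/

section CleanSimplex

open Finset

variable {d : ℕ} {v : Fin (d + 1) → Fin d → ℤ}

theorem mem_interior_iff_coord_pos (hv : AffineIndependent ℝ fun j => latticePoint (v j))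
    (x : Fin d → ℝ) : x ∈ interior (convexHull ℝ (Set.range fun j => latticePoint (v j))) ↔
      ∀ i, 0 < (vertexBasis hv).coord i x := by
  rw [← coe_vertexBasis hv, AffineBasis.interior_convexHull]; rfl

theorem mem_convexHull_iff_coord_nonneg (hv : AffineIndependent ℝ fun j => latticePoint (v j))
    (x : Fin d → ℝ) : x ∈ convexHull ℝ (Set.range fun j => latticePoint (v j)) ↔
      ∀ i, 0 ≤ (vertexBasis hv).coord i x := by
  rw [← coe_vertexBasis hv, AffineBasis.convexHull_eq_nonneg_coord]; rfl

theorem mem_frontier_iff_coord (hv : AffineIndependent ℝ fun j => latticePoint (v j))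
    (x : Fin d → ℝ) : x ∈ frontier (convexHull ℝ (Set.range fun j => latticePoint (v j))) ↔
      (∀ i, 0 ≤ (vertexBasis hv).coord i x) ∧ ∃ i, (vertexBasis hv).coord i x = 0 := by
  have hclosed : IsClosed (convexHull ℝ (Set.range fun j => latticePoint (v j))) :=
    (Set.finite_range _).isClosed_convexHull ℝ
  rw [hclosed.frontier_eq, Set.mem_sdiff, mem_convexHull_iff_coord_nonneg hv,
    mem_interior_iff_coord_pos hv]
  refine and_congr_right fun h => ?_
  push Not
  exact exists_congr fun i => ⟨fun hi => le_antisymm hi (h i), fun hi => hi.le⟩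

theorem extremePoints_lattice_simplex (hv : AffineIndependent ℝ fun j => latticePoint (v j)) :
    (convexHull ℝ (Set.range fun j => latticePoint (v j))).extremePoints ℝ =
      Set.range fun j => latticePoint (v j) :=
  (vertexBasis hv).extremePoints_convexHull_range

theorem exists_lattice_of_mem_modularKernel {N : ℕ} [NeZero N] {x : Fin (d + 1) → ZMod N}
    (hx : x ∈ modularKernel (vertexMatrix v) N) (hsum : ∑ i, (x i).val = N) :
    ∃ z : Fin d → ℤ, (fun i => ((x i).val : ℤ)) ᵥ* vertexMatrix v = (N : ℤ) • Fin.cons 1 z := by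
  have hx' : (fun i => (((x i).val : ℤ) : ZMod N)) = x := by ext i; simp
  rw [← hx', intCast_comp_mem_modularKernel] at hx
  obtain ⟨y, hy⟩ := hx
  refine ⟨Fin.tail y, ?_⟩
  have h0 := congrFun hy 0
  rw [vecMul_vertexMatrix_zero] at h0
  have hsum' : ∑ i, ((x i).val : ℤ) = N := by exact_mod_cast hsum
  have hN : (N : ℤ) ≠ 0 := by exact_mod_cast NeZero.ne N
  have hy0 : y 0 = 1 := by
    rw [hsum', Pi.smul_apply, smul_eq_mul] at h0
    exact mul_left_cancel₀ hN (by rw [← h0, mul_one])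
  rw [hy, ← hy0, Fin.cons_self_tail]

/-- The height system attached to a clean lattice simplex. -/
def latticeHeightSystem {N : ℕ} [NeZero N] (hN : normalizedVolume v = N)
    (hv : AffineIndependent ℝ fun j => latticePoint (v j))
    (hclean : IsClean (convexHull ℝ (Set.range fun j => latticePoint (v j)))) :
    HeightSystem d N (modularKernel (vertexMatrix v) N) where
  coord i := (Pi.evalAddMonoidHom _ i).comp (modularKernel (vertexMatrix v) N).subtype
  sum_coord x := by
    have h := congrFun (mem_modularKernel.mp x.2) 0
    have h2 : ∑ i, x.1 i = 0 := by simpa [Matrix.vecMul, dotProduct, vertexMatrix] using h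
    exact h2
  eq_zero_of_coord x hx := by
    exact Subtype.ext (funext hx)
  clean := by
    rintro ⟨x, hx⟩ hsum i hi
    replace hsum : ∑ i, (x i).val = N := hsum
    replace hi : x i = 0 := hi
    obtain ⟨z, hz⟩ := exists_lattice_of_mem_modularKernel hx hsum
    have hcoord := coord_latticePoint hv (hz.trans (by rw [hN]))
    have hfront : latticePoint z ∈
        frontier (convexHull ℝ (Set.range fun j => latticePoint (v j))) ∩ integerLattice d := by
      refine ⟨(mem_frontier_iff_coord hv _).mpr ⟨fun j => ?_, i, ?_⟩, z, rfl⟩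
      · rw [hcoord]; positivity
      · rw [hcoord, hi]; simp
    -- A height-one element with a zero coordinate would be a boundary lattice point, hence a
    -- vertex; but its coordinates are residues over N, so none of them equals 1.
    rw [IsClean] at hclean
    rw [hclean, extremePoints_lattice_simplex hv] at hfront
    obtain ⟨j, hj⟩ := hfront
    have h1 := (vertexBasis hv).coord_apply_eq j
    rw [show vertexBasis hv j = latticePoint z from hj, hcoord, hN,
      div_eq_one_iff_eq (by exact_mod_cast NeZero.ne N)] at h1
    have h2 := ZMod.val_lt (x j)
    have h3 : (x j).val = N := by exact_mod_cast h1
    omega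

theorem card_level_one_latticeHeightSystem {N : ℕ} [NeZero N] (hN : normalizedVolume v = N)
    (hv : AffineIndependent ℝ fun j => latticePoint (v j))
    (hclean : IsClean (convexHull ℝ (Set.range fun j => latticePoint (v j)))) (hd : 1 ≤ d) {k : ℕ}
    (hk : (interior (convexHull ℝ (Set.range fun j => latticePoint (v j))) ∩
      integerLattice d).encard = k) [Fintype (modularKernel (vertexMatrix v) N)] :
    #((latticeHeightSystem hN hv hclean).level 1) = k + 1 := by
  classical
  obtain ⟨S, hS⟩ : ∃ S, S = latticeHeightSystem hN hv hclean := ⟨_, rfl⟩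
  have hsize : ∀ x, S.size x = ∑ i, (x.1 i).val := fun x => hS ▸ rfl
  rw [← hS]
  have hNR : (N : ℝ) ≠ 0 := by exact_mod_cast NeZero.ne N
  let pt : modularKernel (vertexMatrix v) N → Fin d → ℝ :=
    fun x => ∑ i, (((x.1 i).val : ℝ) / N) • vertexBasis hv i
  have hpt : ∀ x, S.size x = N → ∀ i, (vertexBasis hv).coord i (pt x) = ((x.1 i).val : ℝ) / N := by
    intro x hx i
    refine AffineBasis.coord_sum_smul _ ?_ i
    rw [hsize] at hx
    rw [← Finset.sum_div, div_eq_one_iff_eq hNR]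
    exact_mod_cast hx
  have hinj : Set.InjOn pt {x | S.size x = N} := by
    intro x hx y hy hxy
    ext i
    refine ZMod.val_injective N ?_
    have h1 := hpt x hx i
    rw [hxy, hpt y hy i, div_left_inj' hNR] at h1
    exact_mod_cast h1.symm
  have himg : pt '' {x | S.size x = N} =
      interior (convexHull ℝ (Set.range fun j => latticePoint (v j))) ∩ integerLattice d := by
    ext p
    constructor
    · rintro ⟨x, hx, rfl⟩
      refine ⟨(mem_interior_iff_coord_pos hv _).mpr fun i => ?_, ?_⟩
      · rw [hpt x hx]
        have := S.clean x hx i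
        have h2 : (x.1 i).val ≠ 0 := by
          rw [Ne, ZMod.val_eq_zero]
          rw [hS] at this
          exact this
        have := Nat.pos_of_ne_zero h2
        have := NeZero.pos N
        positivity
      · have hx' : ∑ i, (x.1 i).val = N := by rw [← hsize]; exact hx
        obtain ⟨z, hz⟩ := exists_lattice_of_mem_modularKernel x.2 hx'
        refine ⟨z, (vertexBasis hv).ext_elem fun i => ?_⟩
        rw [hpt x hx, coord_latticePoint hv (hz.trans (by rw [hN])), hN]
        simp
    · rintro ⟨hp, z, rfl⟩
      rw [mem_interior_iff_coord_pos hv] at hp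
      obtain ⟨c, hc⟩ := exists_vecMul_vertexMatrix v (Fin.cons 1 z)
      have hcpos : ∀ i, 0 < c i := by
        intro i
        have h1 := hp i
        rw [coord_latticePoint hv hc, hN] at h1
        have h2 : (0 : ℝ) < N := by exact_mod_cast NeZero.pos N
        have := (div_pos_iff_of_pos_right h2).mp h1
        exact_mod_cast this
      have hcsum : ∑ i, c i = N := by
        rw [← vecMul_vertexMatrix_zero v, hc, hN]
        simp
      -- A second positive coordinate, available since d ≥ 1, keeps each numerator below N, so
      -- reduction mod N loses nothing.
      have hclt : ∀ i, c i < N := by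
        intro i
        obtain ⟨j, hj⟩ : ∃ j, j ≠ i := by
          have : Nontrivial (Fin (d + 1)) := Fin.nontrivial_iff_two_le.mpr (by omega)
          exact exists_ne i
        rw [← hcsum]
        exact single_lt_sum hj (mem_univ i) (mem_univ j) (hcpos j) fun k _ _ => (hcpos k).le
      have hval : ∀ i, (((c i : ZMod N)).val : ℤ) = c i := fun i => by
        rw [ZMod.val_intCast, Int.emod_eq_of_lt (hcpos i).le (hclt i)]
      have hmem : (fun i => (c i : ZMod N)) ∈ modularKernel (vertexMatrix v) N :=
        intCast_comp_mem_modularKernel.mpr ⟨_, hN ▸ hc⟩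
      have hxs : S.size ⟨_, hmem⟩ = N := by
        rw [hsize]
        have : ((∑ i, ((c i : ZMod N)).val : ℕ) : ℤ) = N := by
          rw [← hcsum, Nat.cast_sum]
          exact sum_congr rfl fun i _ => hval i
        exact_mod_cast this
      refine ⟨⟨_, hmem⟩, hxs, (vertexBasis hv).ext_elem fun i => ?_⟩
      rw [hpt _ hxs, coord_latticePoint hv hc, hN]
      congr 1
      exact_mod_cast hval i
  have hcard : ((S.level 1).erase 0 : Set (modularKernel (vertexMatrix v) N)) =
      {x | S.size x = N} := by
    ext x
    simp only [coe_erase, Set.mem_sdiff, mem_coe, Set.mem_singleton_iff, Set.mem_ofPred_eq]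
    constructor
    · rintro ⟨hx, hx0⟩
      exact S.size_eq_of_mem_level_one hx hx0
    · intro hx
      refine ⟨S.mem_level.mpr (by rw [hx, one_mul]), fun h0 => ?_⟩
      rw [h0, S.size_zero] at hx
      exact NeZero.ne N hx.symm
  rw [← himg, hinj.encard_image, ← hcard, Set.encard_coe_eq_coe_finsetCard,
    card_erase_of_mem (S.zero_mem_level 1)] at hk
  have h1 : #(S.level 1) - 1 = k := by exact_mod_cast hk
  have h2 : 0 < #(S.level 1) := card_pos.mpr ⟨0, S.zero_mem_level 1⟩
  omega

end CleanSimplex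

/-! ### The simplex S_d(k) -/

section StandardSimplex

variable {d k : ℕ}

/-- The vertices of `S_d(k)`. -/
def standardVertices (d k : ℕ) : Fin (d + 1) → Fin d → ℤ :=
  Fin.cons (fun _ => -(k : ℤ)) fun i => Pi.single i 1

theorem standardSimplex_eq_convexHull (d k : ℕ) :
    standardSimplex d k = convexHull ℝ (Set.range fun j => latticePoint (standardVertices d k j)) := by
  have h : (fun j => latticePoint (standardVertices d k j)) =
      Fin.cons (-(k : ℝ) • ∑ i : Fin d, (Pi.single i 1 : Fin d → ℝ))
        fun i : Fin d => (Pi.single i 1 : Fin d → ℝ) := by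
    ext j l
    refine Fin.cases ?_ (fun j => ?_) j
    · simp [latticePoint, standardVertices, Finset.sum_apply, Pi.single_apply]
    · simp [latticePoint, standardVertices, Pi.single_apply]
  rw [h, Fin.range_cons, standardSimplex]

theorem sum_mul_standardVertices {R : Type*} [CommRing R] (c : Fin (d + 1) → R) (j : Fin d) :
    ∑ i, c i * (standardVertices d k i j : R) = c j.succ - k * c 0 := by
  rw [Fin.sum_univ_succ]
  simp [standardVertices, Pi.single_apply]
  ring

theorem affineIndependent_standardVertices (d k : ℕ) :
    AffineIndependent ℝ fun j => latticePoint (standardVertices d k j) := by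
  rw [affineIndependent_iff_of_fintype]
  intro w hw hw0
  rw [Finset.univ.weightedVSub_eq_linear_combination hw] at hw0
  have h1 : ∀ j : Fin d, w j.succ = k * w 0 := by
    intro j
    have := congrFun hw0 j
    simp only [Finset.sum_apply, Pi.smul_apply, latticePoint, smul_eq_mul, Pi.zero_apply] at this
    rw [sum_mul_standardVertices] at this
    linarith
  rw [Fin.sum_univ_succ] at hw
  simp only [h1, Finset.sum_const, Finset.card_univ, Fintype.card_fin, nsmul_eq_mul] at hw
  have h2 : w 0 * (1 + d * k) = 0 := by linarith
  have h3 : w 0 = 0 := (mul_eq_zero.mp h2).resolve_right (by positivity)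
  intro i
  refine Fin.cases h3 (fun i => ?_) i
  rw [h1, h3, mul_zero]

theorem normalizedVolume_standardVertices (d k : ℕ) :
    normalizedVolume (standardVertices d k) = d * k + 1 := by
  have h : edgeMatrix (standardVertices d k) =
      1 + Matrix.replicateCol Unit (fun _ => (k : ℤ)) *
        Matrix.replicateRow Unit (fun _ : Fin d => (1 : ℤ)) := by
    ext i j
    simp [edgeMatrix, standardVertices, Matrix.one_apply, Pi.single_apply, Matrix.mul_apply,
      eq_comm]
  rw [normalizedVolume, det_vertexMatrix, h, Matrix.det_one_add_replicateCol_mul_replicateRow]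
  simp [dotProduct]
  omega

theorem coord_standardVertices (z : Fin d → ℤ) :
    (Fin.cons (1 - ∑ i, z i) fun i => (d * k + 1) * z i + k * (1 - ∑ i, z i) :
      Fin (d + 1) → ℤ) ᵥ* vertexMatrix (standardVertices d k) =
        (normalizedVolume (standardVertices d k) : ℤ) • Fin.cons 1 z := by
  rw [normalizedVolume_standardVertices]
  ext j
  refine Fin.cases ?_ (fun j => ?_) j
  · rw [vecMul_vertexMatrix_zero, Fin.sum_univ_succ]
    simp [Finset.sum_add_distrib, ← Finset.mul_sum]
    ring
  · rw [vecMul_vertexMatrix_succ]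
    have := sum_mul_standardVertices (k := k) (Fin.cons (1 - ∑ i, z i) fun i =>
      (d * k + 1) * z i + k * (1 - ∑ i, z i) : Fin (d + 1) → ℤ) j
    simp only [Int.cast_id] at this
    rw [this]
    simp

/-- A lattice point of `S_d(k)` with a vanishing barycentric coordinate is a vertex. -/
theorem eq_standardVertices {z : Fin d → ℤ} (h0 : 0 ≤ 1 - ∑ i, z i)
    (h : ∀ i, 0 ≤ (d * k + 1) * z i + k * (1 - ∑ i, z i))
    (hz : 1 - ∑ i, z i = 0 ∨ ∃ i, (d * k + 1) * z i + k * (1 - ∑ i, z i) = 0) :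
    ∃ j, z = standardVertices d k j := by
  obtain ⟨s, hs⟩ : ∃ s, s = 1 - ∑ i, z i := ⟨_, rfl⟩
  rw [← hs] at h0 h hz
  have hN : (0 : ℤ) < d * k + 1 := by positivity
  have htot : ∑ i, ((d * k + 1) * z i + k * s) = (d * k + 1) - s := by
    rw [Finset.sum_add_distrib, ← Finset.mul_sum, Finset.sum_const, Finset.card_univ,
      Fintype.card_fin, nsmul_eq_mul, show ∑ i, z i = 1 - s by omega]
    ring
  have hcases : s = 0 ∨ s = d * k + 1 := by
    rcases hz with hz | ⟨i, hi⟩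
    · exact Or.inl hz
    -- A zero coordinate gives dk + 1 ∣ ks, and dk + 1 is coprime to k. With 0 ≤ s ≤ dk + 1 only the
    -- two extreme values of s remain.
    · have hdvd : (d * k + 1 : ℤ) ∣ s := by
        have h1 : (d * k + 1 : ℤ) ∣ k * s := ⟨-z i, by linarith⟩
        refine IsCoprime.dvd_of_dvd_mul_left (y := (k : ℤ)) ⟨1, -(d : ℤ), by ring⟩ h1
      obtain ⟨t, ht⟩ := hdvd
      have hle : s ≤ d * k + 1 := by
        have := Finset.sum_nonneg fun i (_ : i ∈ Finset.univ) => h i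
        omega
      have ht0 : 0 ≤ t := by
        by_contra! hneg
        nlinarith
      have ht1 : t ≤ 1 := by
        by_contra! hneg
        nlinarith
      obtain rfl | rfl : t = 0 ∨ t = 1 := by omega
      · left; simpa using ht
      · right; simpa using ht
  rcases hcases with hs0 | hsN
  · have hz0 : ∀ i, 0 ≤ z i := fun i => by
      have := h i
      rw [hs0, mul_zero, add_zero] at this
      exact nonneg_of_mul_nonneg_right this hN
    have hsum : ∑ i, z i = 1 := by omega
    obtain ⟨i, -, hi⟩ : ∃ i ∈ Finset.univ, 0 < z i := by
      by_contra! hcon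
      have := Finset.sum_nonpos hcon
      omega
    refine ⟨i.succ, funext fun j => ?_⟩
    have hadd := Finset.add_sum_erase Finset.univ z (Finset.mem_univ i)
    have hrest : ∑ x ∈ Finset.univ.erase i, z x = 0 := by
      have := Finset.sum_nonneg fun j (_ : j ∈ Finset.univ.erase i) => hz0 j
      omega
    rw [standardVertices, Fin.cons_succ, Pi.single_apply]
    split_ifs with hij
    · rw [hij]; omega
    · exact (Finset.sum_eq_zero_iff_of_nonneg fun j _ => hz0 j).mp hrest j
        (Finset.mem_erase.mpr ⟨hij, Finset.mem_univ j⟩)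
  · refine ⟨0, funext fun j => ?_⟩
    rw [hsN, sub_self] at htot
    have := (Finset.sum_eq_zero_iff_of_nonneg fun j _ => hsN ▸ h j).mp htot j (Finset.mem_univ j)
    rw [standardVertices, Fin.cons_zero]
    have h2 : (d * k + 1 : ℤ) * (z j + k) = 0 := by linarith
    have := (mul_eq_zero.mp h2).resolve_left hN.ne'
    omega

/-- The interior lattice points of `S_d(k)` are `-t (e_1 + ⋯ + e_d)` for `0 ≤ t < k`. -/
theorem standardSimplex_interior_iff (hd : 1 ≤ d) {z : Fin d → ℤ} :
    (0 < 1 - ∑ i, z i ∧ ∀ i, 0 < (d * k + 1) * z i + k * (1 - ∑ i, z i)) ↔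
      ∃ t < k, z = fun _ => -(t : ℤ) := by
  constructor
  · rintro ⟨h0, h⟩
    obtain ⟨s, hs⟩ : ∃ s, s = 1 - ∑ i, z i := ⟨_, rfl⟩
    rw [← hs] at h0 h
    have hd' : (0 : ℤ) < d := by exact_mod_cast hd
    -- For the point -t(e_1 + ⋯ + e_d) one has s = dt + 1, so t is read off from s - 1. Positivity
    -- forces z i + t ≥ 0 while these numbers sum to -r ≤ 0, so all of them vanish.
    obtain ⟨t, r, hr0, hrd, htr⟩ : ∃ t r : ℤ, 0 ≤ r ∧ r < d ∧ s - 1 = d * t + r :=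
      ⟨(s - 1) / d, (s - 1) % d, Int.emod_nonneg _ hd'.ne', Int.emod_lt_of_pos _ hd',
        (Int.mul_ediv_add_emod _ _).symm⟩
    have ht0 : 0 ≤ t := by
      by_contra! hneg
      nlinarith
    have hzt : ∀ i, 0 ≤ z i + t := by
      intro i
      have h1 := h i
      have h2 : (k : ℤ) * (r + 1) ≤ k * d := mul_le_mul_of_nonneg_left (by omega) (by positivity)
      have h3 : s = d * t + r + 1 := by omega
      have h4 : (d * k + 1 : ℤ) * z i + k * s =
          (d * k + 1) * (z i + t) + (k * (r + 1) - t) := by rw [h3]; ring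
      by_contra! hneg
      have h5 : (d * k + 1 : ℤ) * (z i + t) ≤ (d * k + 1) * (-1) :=
        mul_le_mul_of_nonneg_left (by omega) (by positivity)
      linarith [mul_comm (k : ℤ) d]
    have hsum : ∑ i, (z i + t) = -r := by
      rw [Finset.sum_add_distrib, Finset.sum_const, Finset.card_univ, Fintype.card_fin,
        nsmul_eq_mul]
      omega
    have hr : r = 0 := by
      have := Finset.sum_nonneg fun i (_ : i ∈ Finset.univ) => hzt i
      omega
    rw [hr, neg_zero] at hsum
    have hall : ∀ i, z i = -t := fun i => by
      have := (Finset.sum_eq_zero_iff_of_nonneg fun j _ => hzt j).mp hsum i (Finset.mem_univ i)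
      omega
    have htk : t < k := by
      have h1 := h ⟨0, hd⟩
      rw [hall, show s = d * t + 1 by omega] at h1
      linarith
    lift t to ℕ using ht0
    exact ⟨t, by exact_mod_cast htk, funext hall⟩
  · rintro ⟨t, ht, rfl⟩
    simp only [Finset.sum_const, Finset.card_univ, Fintype.card_fin, nsmul_eq_mul]
    have ht' : (t : ℤ) < k := by exact_mod_cast ht
    have h1 : (0 : ℤ) ≤ d * t := by positivity
    refine ⟨by linarith, fun _ => ?_⟩
    linarith [mul_comm (d * (k : ℤ)) t]

theorem standardSimplex_mem_cleanSimplices (d k : ℕ) (hd : 1 ≤ d) :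
    standardSimplex d k ∈ cleanSimplices d k := by
  have hv := affineIndependent_standardVertices d k
  have hN : (0 : ℝ) < normalizedVolume (standardVertices d k) := by
    exact_mod_cast normalizedVolume_pos hv
  have hcoord : ∀ z i, (vertexBasis hv).coord i (latticePoint z) = _ := fun z i =>
    coord_latticePoint hv (coord_standardVertices z) i
  rw [standardSimplex_eq_convexHull]
  refine ⟨⟨_, hv, rfl⟩, ?_, ?_⟩
  · rw [IsClean, extremePoints_lattice_simplex hv]
    ext p
    constructor
    · rintro ⟨hp, z, rfl⟩
      rw [mem_frontier_iff_coord hv] at hp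
      simp only [hcoord, Fin.forall_fin_succ, Fin.exists_fin_succ, Fin.cons_zero, Fin.cons_succ,
        le_div_iff₀ hN, zero_mul, div_eq_zero_iff, hN.ne', or_false] at hp
      obtain ⟨⟨h1, h2⟩, h3⟩ := hp
      obtain ⟨j, hj⟩ := eq_standardVertices (k := k) (z := z) (by exact_mod_cast h1)
        (fun i => by exact_mod_cast h2 i) (h3.imp (fun h => by exact_mod_cast h)
          (fun ⟨i, hi⟩ => ⟨i, by exact_mod_cast hi⟩))
      exact ⟨j, by rw [hj]⟩
    · rintro ⟨j, rfl⟩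
      refine ⟨(mem_frontier_iff_coord hv _).mpr ?_, _, rfl⟩
      have hb : ∀ i, (vertexBasis hv).coord i (latticePoint (standardVertices d k j)) =
          if i = j then 1 else 0 := fun i => (vertexBasis hv).coord_apply i j
      refine ⟨fun i => ?_, ?_⟩
      · rw [hb]; split_ifs <;> norm_num
      · have : Nontrivial (Fin (d + 1)) := Fin.nontrivial_iff_two_le.mpr (by omega)
        obtain ⟨i, hi⟩ := exists_ne j
        exact ⟨i, by rw [hb, if_neg hi]⟩
  · have hset : interior (convexHull ℝ (Set.range fun j =>
        latticePoint (standardVertices d k j))) ∩ integerLattice d =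
        (fun t : ℕ => latticePoint fun _ : Fin d => -(t : ℤ)) '' (Finset.range k : Set ℕ) := by
      ext p
      constructor
      · rintro ⟨hp, z, rfl⟩
        rw [mem_interior_iff_coord_pos hv] at hp
        simp only [hcoord, Fin.forall_fin_succ, Fin.cons_zero, Fin.cons_succ,
          div_pos_iff_of_pos_right hN] at hp
        obtain ⟨t, ht, rfl⟩ := (standardSimplex_interior_iff (k := k) hd).mp
          ⟨by exact_mod_cast hp.1, fun i => by exact_mod_cast hp.2 i⟩
        exact ⟨t, by simpa using ht, rfl⟩
      · rintro ⟨t, ht, rfl⟩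
        obtain ⟨h1, h2⟩ := (standardSimplex_interior_iff (k := k) hd).mpr
          ⟨t, by simpa using ht, rfl⟩
        refine ⟨(mem_interior_iff_coord_pos hv _).mpr ?_, _, rfl⟩
        simp only [hcoord, Fin.forall_fin_succ, Fin.cons_zero, Fin.cons_succ,
          div_pos_iff_of_pos_right hN]
        exact ⟨by exact_mod_cast h1, fun i => by exact_mod_cast h2 i⟩
    have hinj : Function.Injective fun t : ℕ => latticePoint fun _ : Fin d => -(t : ℤ) := by
      intro a b hab
      have := congrFun hab ⟨0, hd⟩
      simpa [latticePoint] using this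
    rw [hset, hinj.encard_image, Set.encard_coe_eq_coe_finsetCard, Finset.card_range]

theorem volume_real_standardSimplex (d k : ℕ) :
    volume.real (standardSimplex d k) = ((d : ℝ) * k + 1) / (d ! : ℝ) := by
  rw [standardSimplex_eq_convexHull,
    volume_real_lattice_simplex (affineIndependent_standardVertices d k),
    normalizedVolume_standardVertices]
  push_cast
  rfl

end StandardSimplex

/-! ### The volume bound and the equality case for simplices -/

section Main

open Finset

variable {d k : ℕ} {v : Fin (d + 1) → Fin d → ℤ}

theorem le_normalizedVolume (hd : 1 ≤ d) (hv : AffineIndependent ℝ fun j => latticePoint (v j))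
    (hclean : IsClean (convexHull ℝ (Set.range fun j => latticePoint (v j))))
    (hk : (interior (convexHull ℝ (Set.range fun j => latticePoint (v j))) ∩
      integerLattice d).encard = k) : d * k + 1 ≤ normalizedVolume v := by
  classical
  have : NeZero (normalizedVolume v) := ⟨(normalizedVolume_pos hv).ne'⟩
  have : Fintype (modularKernel (vertexMatrix v) (normalizedVolume v)) := Fintype.ofFinite _
  have h := (latticeHeightSystem rfl hv hclean).le_card
    (card_level_one_latticeHeightSystem rfl hv hclean hd hk)
  rw [← Nat.card_eq_fintype_card] at h
  exact h.trans (card_modularKernel_le _ (det_vertexMatrix_ne_zero hv))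

/-- A clean simplex of least volume has a lattice point with barycentric coordinates proportional
to `(k, …, k, 1)`. -/
theorem exists_lattice_of_normalizedVolume_eq (hd : 3 ≤ d)
    (hv : AffineIndependent ℝ fun j => latticePoint (v j))
    (hclean : IsClean (convexHull ℝ (Set.range fun j => latticePoint (v j))))
    (hk : (interior (convexHull ℝ (Set.range fun j => latticePoint (v j))) ∩
      integerLattice d).encard = k) (hN : normalizedVolume v = d * k + 1) :
    ∃ (z : Fin d → ℤ) (i₀ : Fin (d + 1)) (c : Fin (d + 1) → ℤ), c i₀ = 1 ∧
      (∀ i, i ≠ i₀ → c i = k) ∧ c ᵥ* vertexMatrix v = (d * k + 1 : ℤ) • Fin.cons 1 z := by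
  classical
  rcases Nat.eq_zero_or_pos k with rfl | hk0
  -- For k = 0 the required coordinates (0, …, 0, 1) are those of a vertex.
  · refine ⟨v 0, 0, Pi.single 0 1, by simp, fun i hi => by simp [hi], ?_⟩
    rw [Matrix.single_one_vecMul]
    ext j
    simp [vertexMatrix]
  have : Fintype (modularKernel (vertexMatrix v) (d * k + 1)) := Fintype.ofFinite _
  have hlevel := card_level_one_latticeHeightSystem hN hv hclean (by omega) hk
  have hG : Fintype.card (modularKernel (vertexMatrix v) (d * k + 1)) = d * k + 1 := by
    refine le_antisymm ?_ ((latticeHeightSystem hN hv hclean).le_card hlevel)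
    have h := card_modularKernel_le (vertexMatrix v) (det_vertexMatrix_ne_zero hv)
    rw [show (vertexMatrix v).det.natAbs = d * k + 1 from hN] at h
    rwa [← Nat.card_eq_fintype_card]
  obtain ⟨h, hh⟩ := (latticeHeightSystem hN hv hclean).exists_size_nsmul_eq hd hk0 hlevel hG
  obtain ⟨g, i₀, hg, hg1, hgk⟩ :=
    (latticeHeightSystem hN hv hclean).exists_coord_eq (by omega) hk0 hG h hh
  obtain ⟨z, hz⟩ := exists_lattice_of_mem_modularKernel g.2 hg
  refine ⟨z, i₀, fun i => ((g.1 i).val : ℤ), ?_, fun i hi => ?_, ?_⟩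
  · exact congrArg (Nat.cast (R := ℤ)) hg1 |>.trans Nat.cast_one
  · exact congrArg (Nat.cast (R := ℤ)) (hgk i hi)
  · rw [hz]; push_cast; rfl

theorem unimodularEquiv_standardSimplex
    (hv : AffineIndependent ℝ fun j => latticePoint (v j))
    (hN : normalizedVolume v = d * k + 1) {z : Fin d → ℤ} {i₀ : Fin (d + 1)}
    {c : Fin (d + 1) → ℤ} (hc1 : c i₀ = 1) (hck : ∀ i, i ≠ i₀ → c i = k)
    (hc : c ᵥ* vertexMatrix v = (d * k + 1 : ℤ) • Fin.cons 1 z) :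
    UnimodularEquiv (convexHull ℝ (Set.range fun j => latticePoint (v j)))
      (standardSimplex d k) := by
  obtain ⟨M, hM⟩ : ∃ M : Matrix (Fin d) (Fin d) ℤ,
      M = Matrix.of fun i => v (i₀.succAbove i) - z := ⟨_, rfl⟩
  have hlin : ∀ w : Fin d → ℤ, integralAffineMap M z (latticePoint w) =
      latticePoint (w ᵥ* M + z) := by
    intro w
    ext j
    simp [integralAffineMap, latticePoint, Matrix.vecMul, dotProduct]
  have hsingle : ∀ i, (Pi.single i 1 : Fin d → ℤ) ᵥ* M + z = v (i₀.succAbove i) := by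
    intro i
    rw [Matrix.single_one_vecMul, hM]
    ext j
    simp
  -- The relation v_{i₀} + k ∑_{i ≠ i₀} v_i = (dk + 1) z, solved for v_{i₀}, is the image of -k ∑
  -- e_i.
  have hbase : (fun _ => -(k : ℤ)) ᵥ* M + z = v i₀ := by
    ext j
    have h := congrFun hc j.succ
    rw [vecMul_vertexMatrix_succ, Fin.sum_univ_succAbove _ i₀, hc1] at h
    simp only [hck _ (Fin.succAbove_ne i₀ _), Pi.smul_apply, Fin.cons_succ, smul_eq_mul,
      ← mul_sum] at h
    simp only [Pi.add_apply, Matrix.vecMul, dotProduct, hM, Matrix.of_apply, Pi.sub_apply,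
      ← mul_sum, sum_sub_distrib, sum_const, card_univ, Fintype.card_fin, nsmul_eq_mul]
    linarith
  have himg : convexHull ℝ (Set.range fun j => latticePoint (v j)) =
      integralAffineMap M z '' standardSimplex d k := by
    rw [standardSimplex_eq_convexHull, ← coe_integralAffineHom, AffineMap.image_convexHull,
      ← Set.range_comp]
    congr 1
    have hcomp : (⇑(integralAffineHom M z) ∘ fun j => latticePoint (standardVertices d k j)) =
        Fin.cons (latticePoint (v i₀)) fun i => latticePoint (v (i₀.succAbove i)) := by
      funext j
      rw [Function.comp_apply, coe_integralAffineHom, hlin]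
      refine Fin.cases ?_ (fun j => ?_) j
      · rw [standardVertices, Fin.cons_zero, hbase, Fin.cons_zero]
      · rw [standardVertices, Fin.cons_succ, hsingle, Fin.cons_succ]
    rw [hcomp, Fin.range_cons]
    ext p
    constructor
    · rintro ⟨j, rfl⟩
      rcases Fin.eq_self_or_eq_succAbove i₀ j with rfl | ⟨i, rfl⟩
      · exact Set.mem_insert _ _
      · exact Set.mem_insert_of_mem _ ⟨i, rfl⟩
    · rintro (rfl | ⟨i, rfl⟩)
      · exact ⟨i₀, rfl⟩
      · exact ⟨_, rfl⟩
  refine ⟨M, z, ?_, himg⟩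
  -- Both simplices have the same positive volume, so the integral map has |det M| = 1.
  have hvol := volume_real_lattice_simplex hv
  rw [himg, volume_real_image_integralAffineMap, volume_real_standardSimplex, hN] at hvol
  have hpos : (0 : ℝ) < ((d : ℝ) * k + 1) / (d ! : ℝ) := by positivity
  have habs : |(M.det : ℝ)| = 1 := by
    rw [Nat.cast_add, Nat.cast_mul, Nat.cast_one] at hvol
    exact mul_right_cancel₀ hpos.ne' (hvol.trans (one_mul _).symm)
  have habs' : |M.det| = 1 := by exact_mod_cast habs
  exact (abs_eq zero_le_one).mp habs'

theorem volume_real_le_of_mem_cleanSimplices (hd : 1 ≤ d) {T : Set (Fin d → ℝ)}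
    (hT : T ∈ cleanSimplices d k) : ((d : ℝ) * k + 1) / (d ! : ℝ) ≤ volume.real T := by
  obtain ⟨⟨v, hv, rfl⟩, hclean, hk⟩ := hT
  rw [volume_real_lattice_simplex hv]
  have h := le_normalizedVolume hd hv hclean hk
  gcongr
  exact_mod_cast h

theorem volume_real_eq_iff_unimodularEquiv (hd : 3 ≤ d) {T : Set (Fin d → ℝ)}
    (hT : T ∈ cleanSimplices d k) :
    volume.real T = ((d : ℝ) * k + 1) / (d ! : ℝ) ↔ UnimodularEquiv T (standardSimplex d k) := by
  constructor
  · intro hvol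
    obtain ⟨⟨v, hv, rfl⟩, hclean, hk⟩ := hT
    rw [volume_real_lattice_simplex hv, div_left_inj' (by positivity)] at hvol
    have hN : normalizedVolume v = d * k + 1 := by exact_mod_cast hvol
    obtain ⟨z, i₀, c, hc1, hck, hc⟩ := exists_lattice_of_normalizedVolume_eq hd hv hclean hk hN
    exact unimodularEquiv_standardSimplex hv hN hc1 hck hc
  · rintro ⟨M, u, hM, rfl⟩
    rw [volume_real_image_integralAffineMap, volume_real_standardSimplex]
    rcases hM with hM | hM <;> simp [hM]

end Main

theorem mainTheorem1 (d k : ℕ) (hd : 3 ≤ d) :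
    (∀ T ∈ cleanSimplices d k,
      volume.real T = ((d : ℝ) * k + 1) / (d ! : ℝ) ↔ UnimodularEquiv T (standardSimplex d k)) ∧
    standardSimplex d k ∈ cleanSimplices d k ∧
    (∀ T ∈ cleanSimplices d k, ((d : ℝ) * k + 1) / (d ! : ℝ) ≤ volume.real T) ∧
    (∃! c : Quotient (unimodularSetoid d),
      ∃ T ∈ minimalVolumeSimplices d k, Quotient.mk (unimodularSetoid d) T = c) := by
  have hS := standardSimplex_mem_cleanSimplices d k (by omega)
  have hle : ∀ T ∈ cleanSimplices d k, ((d : ℝ) * k + 1) / (d ! : ℝ) ≤ volume.real T :=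
    fun T hT => volume_real_le_of_mem_cleanSimplices (by omega) hT
  refine ⟨fun T hT => volume_real_eq_iff_unimodularEquiv hd hT, hS, hle,
    Quotient.mk (unimodularSetoid d) (standardSimplex d k), ⟨standardSimplex d k, ⟨hS, ?_⟩, rfl⟩, ?_⟩
  · rw [volume_real_standardSimplex]
    exact hle
  · rintro _ ⟨T, ⟨hT, hmin⟩, rfl⟩
    refine Quotient.sound ((volume_real_eq_iff_unimodularEquiv hd hT).mp (le_antisymm ?_ (hle T hT)))
    have := hmin _ hS
    rwa [volume_real_standardSimplex] at this
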